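/- Let $(\Omega,\mathcal F,\mathbb Q)$ be a probability space with a filtration $(\mathcal F_t)_{t\ge0}$ satisfying the usual conditions, and let $\mathbf X=(\mathbf X(t))_{t\ge 0}$ be an adapted càdlàg process with values in $\mathbb R^n$. For Borel functions $f,g:\mathbb R^n\to\mathbb R$ we say that $f$ is in the domain of the extended generator $\mathcal G$ of $\mathbf X$ under $\mathbb Q$, with $\mathcal Gf=g$, if $\int_0^t|g(\mathbf X(s))|\,ds<\infty$ for all $t\ge0$ almost surely and $f(\mathbf X(t))-f(\mathbf X(0))-\int_0^t g(\mathbf X(s))\,ds$, $t\ge 0$, is a $\mathbb Q$-local martingale. The process $\mathbf X$ is called a *polynomial process* under $\mathbb Q$ if for every $k\ge0$ every polynomial $p$ on $\mathbb R^n$ of degree at most $k$ is in this domain, with $\mathcal Gp$ a polynomial of degree at most $k$. It is called *$\mathbb Q$-integrable* if $\mathbb E_{\mathbb Q}|\mathbf X(t)|<\infty$ for all $t\ge0$, and *$\mathbb Q$-affine* if it is $\mathbb Q$-integrable and there are measurable deterministic maps $(t,T)\mapsto\mathcal A(t,T)\in\mathbb R^{n\times n}$ and $(t,T)\mapsto\mathbf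 a(t,T)\in\mathbb R^n$ with $\mathbb E_{\mathbb Q}[\mathbf X(T)\,|\,\mathcal F_t]=\mathcal A(t,T)\mathbf X(t)+\mathbf a(t,T)$ almost surely for all $0\le t\le T<\infty$. **Proposition.** Let $\mathbf X$ be a polynomial process under $\mathbb Q$ whose initial value $\mathbf X(0)$ is $\mathbb Q$-integrable (for instance deterministic). Then $\mathbf X$ is $\mathbb Q$-integrable and $\mathbb Q$-affine. Moreover, there are $G\in\mathbb R^{n\times n}$ and $\mathbf b\in\mathbb R^n$ with $\mathcal G\mathbf x=G\mathbf x+\mathbf b$ (coordinatewise), and for all such $G,\mathbf b$ and all $0\le t\le T<\infty$, almost surely, $$\mathbb E_{\mathbb Q}[\mathbf X(T)\,|\,\mathcal F_t]=e^{G(T-t)}\mathbf X(t)+\int_t^Te^{G(T-s)}\mathbf b\,ds .$$ In particular, the affine property holds with maps $\mathcal A(t,T)=e^{G(T-t)}$ and $\mathbf a(t,T)=\int_t^Te^{G(T-s)}\mathbf b\,ds$ that are measurable and depend on $T-t$ only. -/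

import Mathlib

open MeasureTheory ProbabilityTheory Filter Topology
open scoped NNReal Matrix

/-- Right-continuous with left limits, for a path indexed by `[0, ∞)`. -/
def IsCadlagPath {E : Type*} [TopologicalSpace E] (x : ℝ≥0 → E) : Prop :=
  ∀ t, ContinuousWithinAt x (Set.Ici t) t ∧ ∃ l, Tendsto x (𝓝[<] t) (𝓝 l)

/-- The usual conditions for the filtration `𝓕` and the probability measure `Q`: right-continuity,
and every `Q`-null set (of the completion) belongs to `𝓕 0`; in particular `Q` is complete. -/
structure UsualConditions {Ω : Type*} {mΩ : MeasurableSpace Ω} (𝓕 : Filtration ℝ≥0 mΩ)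
    (Q : Measure Ω) : Prop where
  rightContinuous : 𝓕.IsRightContinuous
  null_mem : ∀ s : Set Ω, Q s = 0 → MeasurableSet[𝓕 0] s

/-- A real `Q`-local martingale: almost surely càdlàg paths, and a localizing sequence of stopping
times along which the stopped processes are martingales. -/
def IsLocalMartingale {Ω : Type*} {mΩ : MeasurableSpace Ω} (𝓕 : Filtration ℝ≥0 mΩ)
    (Q : Measure Ω) (M : ℝ≥0 → Ω → ℝ) : Prop :=
  (∀ᵐ ω ∂Q, IsCadlagPath (fun t => M t ω)) ∧ Locally (fun N => Martingale N 𝓕 Q) 𝓕 M Q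

/-- The process `f(X(t)) - f(X(0)) - ∫₀ᵗ g(X(s)) ds`. -/
noncomputable def dynkinProcess {Ω : Type*} {n : ℕ} (X : ℝ≥0 → Ω → (Fin n → ℝ))
    (f g : (Fin n → ℝ) → ℝ) (t : ℝ≥0) (ω : Ω) : ℝ :=
  f (X t ω) - f (X 0 ω) - ∫ s in (0 : ℝ)..t, g (X s.toNNReal ω)

/-- `f` is in the domain of the extended generator `𝒢` of `X` under `Q`, and `𝒢 f = g` (that is,
`g` is a version of `𝒢 f`): the pair `(f, g)` solves the local martingale problem along `X`.
Only the values of `f` and `g` on the state space of `X` matter. -/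
def ExtendedGenerator {Ω : Type*} {mΩ : MeasurableSpace Ω} {n : ℕ} (𝓕 : Filtration ℝ≥0 mΩ)
    (Q : Measure Ω) (X : ℝ≥0 → Ω → (Fin n → ℝ)) (f g : (Fin n → ℝ) → ℝ) : Prop :=
  Measurable f ∧ Measurable g ∧
    (∀ᵐ ω ∂Q, ∀ t : ℝ≥0,
      IntervalIntegrable (fun s : ℝ => g (X s.toNNReal ω)) volume 0 t) ∧
    IsLocalMartingale 𝓕 Q (dynkinProcess X f g)

/-- `X` is a polynomial process under `Q`: an adapted càdlàg process in `ℝⁿ` whose extended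
generator maps polynomials of degree at most `k` to polynomials of degree at most `k`, for
every `k`. Neither moments nor true martingale properties are part of the definition. -/
structure IsPolynomialProcess {Ω : Type*} {mΩ : MeasurableSpace Ω} {n : ℕ}
    (𝓕 : Filtration ℝ≥0 mΩ) (Q : Measure Ω) (X : ℝ≥0 → Ω → (Fin n → ℝ)) : Prop where
  adapted : StronglyAdapted 𝓕 X
  cadlag : ∀ ω, IsCadlagPath (fun t => X t ω)
  generator_polynomial : ∀ (k : ℕ) (p : MvPolynomial (Fin n) ℝ), p.totalDegree ≤ k →
    ∃ q : MvPolynomial (Fin n) ℝ, q.totalDegree ≤ k ∧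
      ExtendedGenerator 𝓕 Q X (fun x => MvPolynomial.eval x p) (fun x => MvPolynomial.eval x q)

/-- `𝒢 x = G x + b`, coordinate by coordinate, for the extended generator `𝒢` of `X`. -/
def GeneratorOnCoordinates {Ω : Type*} {mΩ : MeasurableSpace Ω} {n : ℕ} (𝓕 : Filtration ℝ≥0 mΩ)
    (Q : Measure Ω) (X : ℝ≥0 → Ω → (Fin n → ℝ)) (G : Matrix (Fin n) (Fin n) ℝ)
    (b : Fin n → ℝ) : Prop :=
  ∀ i, ExtendedGenerator 𝓕 Q X (fun x => x i) (fun x => (G *ᵥ x + b) i)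

/-- `X` is `Q`-integrable: `X(t)` is `Q`-integrable for every `t ≥ 0`. -/
def IsIntegrableProcess {Ω : Type*} {mΩ : MeasurableSpace Ω} {n : ℕ} (Q : Measure Ω)
    (X : ℝ≥0 → Ω → (Fin n → ℝ)) : Prop :=
  ∀ t, Integrable (X t) Q

/-- `X` is `Q`-affine with the measurable deterministic maps `𝒜` and `a`:
`E_Q[X(T) | 𝓕ₜ] = 𝒜(t,T) X(t) + a(t,T)` almost surely for `0 ≤ t ≤ T`. The existence of the
conditional expectations is part of the definition. -/
structure IsAffineWith {Ω : Type*} {mΩ : MeasurableSpace Ω} {n : ℕ} (𝓕 : Filtration ℝ≥0 mΩ)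
    (Q : Measure Ω) (X : ℝ≥0 → Ω → (Fin n → ℝ)) (𝒜 : ℝ≥0 → ℝ≥0 → Matrix (Fin n) (Fin n) ℝ)
    (a : ℝ≥0 → ℝ≥0 → (Fin n → ℝ)) : Prop where
  measurable_matrix : ∀ i j, Measurable (fun r : ℝ≥0 × ℝ≥0 => 𝒜 r.1 r.2 i j)
  measurable_vector : Measurable (fun r : ℝ≥0 × ℝ≥0 => a r.1 r.2)
  integrable : IsIntegrableProcess Q X
  condExp_eq : ∀ t T : ℝ≥0, t ≤ T → Q[X T | 𝓕 t] =ᵐ[Q] fun ω => 𝒜 t T *ᵥ X t ω + a t T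

/-- `X` is `Q`-affine. -/
def IsAffineProcess {Ω : Type*} {mΩ : MeasurableSpace Ω} {n : ℕ} (𝓕 : Filtration ℝ≥0 mΩ)
    (Q : Measure Ω) (X : ℝ≥0 → Ω → (Fin n → ℝ)) : Prop :=
  ∃ 𝒜 a, IsAffineWith 𝓕 Q X 𝒜 a

/-- A function of `0 ≤ t ≤ T` that depends on `T - t` only. -/
def IsHomogeneous {α : Type*} (f : ℝ≥0 → ℝ≥0 → α) : Prop :=
  ∃ g : ℝ≥0 → α, ∀ t T, t ≤ T → f t T = g (T - t)

/-! One quadratic polynomial controls the process. Put Y = 1 + ∑ Xᵢ². Its drift is a polynomial of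
degree at most two in X, hence at most C·Y, so e^{-Ct}Y_t is a nonnegative supermartingale in the
weighted sense E[w e^{-Ct}Y_t] ≤ E[w e^{-Cs}Y_s] for 𝓕ₛ-measurable weights 0 ≤ w ≤ 1, where either
side may be infinite (`lintegral_discounted_le`). No stochastic integration enters: a pathwise
integration by parts and Fubini handle the discounting of the stopped martingales, and Fatou removes
the localization.

Since only X(0) itself is integrable, E[Y_0] may be infinite; weights known at time 0 repair this.
With w = 1/(1+‖X(0)‖) the mean of wY_0 is finite, and ‖X_u‖ ≤ wY_u + 1 + ‖X(0)‖ bounds first moments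
on compact time intervals (`IsPolynomialProcess.exists_first_moment_bound`). With w the indicator of
{‖X(0)‖ ≤ m}, second moments are bounded uniformly over stopping times capped at t. This uses
optional stopping (`lintegral_weight_mul_cappedTime_le`), because a sequence localizing a coordinate
need not be the one that localizes Y. The resulting uniform integrability removes the localization
on that event, and m → ∞ yields the Dynkin formula for the coordinates
(`setIntegral_eq_add_integral_drift`).

Polynomials of degree at most one are affine, so for B ∈ 𝓕ₜ the vector u(v) = E[1_B X(v)] solves u'
= Gu + Q(B)b in integral form. Variation of constants (`eq_exp_mulVec_add_integral`) gives u(T), and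
these set integrals determine the conditional expectation. -/

/-! ### Càdlàg paths: boundedness, measurability, integrals -/

/-- A continuous function of a càdlàg path is càdlàg. -/
theorem IsCadlagPath.comp_continuous {E F : Type*} [TopologicalSpace E] [TopologicalSpace F]
    {x : ℝ≥0 → E} (hx : IsCadlagPath x) {φ : E → F} (hφ : Continuous φ) :
    IsCadlagPath (fun t => φ (x t)) := by
  intro t
  obtain ⟨h1, l, h2⟩ := hx t
  exact ⟨hφ.continuousAt.comp_continuousWithinAt h1, φ l, (hφ.tendsto l).comp h2⟩

/-- A càdlàg path is bounded on compact intervals. -/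
theorem IsCadlagPath.exists_bound {x : ℝ≥0 → ℝ} (hx : IsCadlagPath x) (T : ℝ≥0) :
    ∃ K, ∀ t ≤ T, ‖x t‖ ≤ K := by
  have key : ∃ K, ∀ t ∈ Set.Icc 0 T, ‖x t‖ ≤ K := by
    refine isCompact_Icc.induction_on (p := fun s => ∃ K, ∀ t ∈ s, ‖x t‖ ≤ K) ⟨0, by simp⟩
      (fun s t hst ⟨K, hK⟩ => ⟨K, fun u hu => hK u (hst hu)⟩) ?_ ?_
    · rintro s t ⟨K, hK⟩ ⟨L, hL⟩
      refine ⟨max K L, ?_⟩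
      rintro u (hu | hu)
      · exact (hK u hu).trans (le_max_left _ _)
      · exact (hL u hu).trans (le_max_right _ _)
    · intro t _
      obtain ⟨h1, l, h2⟩ := hx t
      have e1 : ∀ᶠ u in 𝓝[≥] t, ‖x u‖ < ‖x t‖ + 1 :=
        (h1.norm).eventually (gt_mem_nhds (lt_add_one _))
      have e2 : ∀ᶠ u in 𝓝[<] t, ‖x u‖ < ‖l‖ + 1 :=
        h2.norm.eventually (gt_mem_nhds (lt_add_one _))
      have e3 : ∀ᶠ u in 𝓝 t, ‖x u‖ ≤ max (‖x t‖ + 1) (‖l‖ + 1) := by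
        rw [← nhdsLT_sup_nhdsGE, eventually_sup]
        exact ⟨e2.mono fun u hu => hu.le.trans (le_max_right _ _),
          e1.mono fun u hu => hu.le.trans (le_max_left _ _)⟩
      exact ⟨_, mem_nhdsWithin_of_mem_nhds e3, _, fun u hu => hu⟩
  obtain ⟨K, hK⟩ := key
  exact ⟨K, fun t ht => hK t ⟨zero_le, ht⟩⟩

/-- Approximation of a time from the right by points of a grid. -/
theorem tendsto_floor_add_one_div (t : ℝ≥0) :
    Tendsto (fun n : ℕ => ((⌊(n + 1 : ℝ≥0) * t⌋₊ + 1 : ℕ) : ℝ≥0) / (n + 1)) atTop (𝓝[≥] t) := by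
  refine tendsto_nhdsWithin_iff.2 ⟨?_, .of_forall fun n => ?_⟩
  · have h : Tendsto (fun n : ℕ => t + 1 / ((n : ℝ≥0) + 1)) atTop (𝓝 t) := by
      simpa using tendsto_const_nhds.add (tendsto_one_div_add_atTop_nhds_zero_nat (𝕜 := ℝ≥0))
    refine tendsto_of_tendsto_of_tendsto_of_le_of_le tendsto_const_nhds h (fun n => ?_) fun n => ?_
    · rw [le_div_iff₀ (by positivity), mul_comm]
      exact_mod_cast (Nat.lt_floor_add_one _).le
    · simp only
      have h0 : ((n : ℝ≥0) + 1) ≠ 0 := by positivity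
      rw [div_le_iff₀ (by positivity), show (t + 1 / ((n : ℝ≥0) + 1)) * (n + 1) = (n + 1) * t + 1 by
        field_simp]
      push_cast
      gcongr
      exact Nat.floor_le zero_le
  · simp only [Set.mem_Ici]
    rw [le_div_iff₀ (by positivity), mul_comm]
    exact_mod_cast (Nat.lt_floor_add_one _).le

/-- A right-continuous process with measurable marginals is jointly measurable. -/
theorem measurable_uncurry_of_rightContinuous {Ω : Type*} [MeasurableSpace Ω]
    {Y : ℝ≥0 → Ω → ℝ} (hY : ∀ t, Measurable (Y t))
    (hc : ∀ ω t, ContinuousWithinAt (fun t => Y t ω) (Set.Ici t) t) :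
    Measurable (Function.uncurry Y) := by
  refine measurable_of_tendsto_metrizable (f := fun (n : ℕ) (p : ℝ≥0 × Ω) =>
    Y (((⌊(n + 1 : ℝ≥0) * p.1⌋₊ + 1 : ℕ) : ℝ≥0) / (n + 1)) p.2) (fun n => ?_) ?_
  · have h1 : Measurable (fun p : ℕ × Ω => Y (((p.1 + 1 : ℕ) : ℝ≥0) / (n + 1)) p.2) :=
      measurable_from_prod_countable_right fun k => hY (((k + 1 : ℕ) : ℝ≥0) / (n + 1))
    exact h1.comp (((Nat.measurable_floor.comp (measurable_fst.const_mul _))).prodMk measurable_snd)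
  · rw [tendsto_pi_nhds]
    rintro ⟨t, ω⟩
    exact (hc ω t).tendsto.comp (tendsto_floor_add_one_div t)

/-- A single path is a process over a one-point sample space. -/
theorem IsCadlagPath.measurable {x : ℝ≥0 → ℝ} (hx : IsCadlagPath x) : Measurable x :=
  (measurable_uncurry_of_rightContinuous (Ω := Unit) (Y := fun t _ => x t)
    (fun _ => measurable_const) fun _ t => (hx t).1).comp
      (measurable_id.prodMk measurable_const : Measurable fun t : ℝ≥0 => (t, ()))

/-- A càdlàg path is interval integrable. -/
theorem IsCadlagPath.intervalIntegrable {x : ℝ≥0 → ℝ} (hx : IsCadlagPath x) (a b : ℝ) :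
    IntervalIntegrable (fun s : ℝ => x s.toNNReal) volume a b := by
  obtain ⟨K, hK⟩ := hx.exists_bound (max a b).toNNReal
  refine (intervalIntegrable_const (c := K) : IntervalIntegrable (fun _ => K) volume a b).mono_fun
    (hx.measurable.comp measurable_real_toNNReal).aestronglyMeasurable ?_
  filter_upwards [ae_restrict_mem measurableSet_uIoc] with s hs
  refine (hK _ (Real.toNNReal_le_toNNReal ?_)).trans (le_abs_self K)
  exact (Set.mem_Ioc.1 hs).2

theorem IsCadlagPath.continuousWithinAt_toNNReal {x : ℝ≥0 → ℝ} (hx : IsCadlagPath x) (u : ℝ) :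
    ContinuousWithinAt (fun s : ℝ => x s.toNNReal) (Set.Ici u) u :=
  ((hx u.toNNReal).1).comp continuous_real_toNNReal.continuousWithinAt
    fun _ hv => Real.toNNReal_le_toNNReal hv

/-- The integral of a càdlàg path has right derivatives. -/
theorem IsCadlagPath.hasDerivWithinAt_integral {g : ℝ≥0 → ℝ} (hg : IsCadlagPath g) (u : ℝ) :
    HasDerivWithinAt (fun v : ℝ => ∫ s in (0 : ℝ)..v, g s.toNNReal) (g u.toNNReal) (Set.Ioi u) u := by
  have hm : Measurable (fun s : ℝ => g s.toNNReal) := hg.measurable.comp measurable_real_toNNReal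
  exact (intervalIntegral.integral_hasDerivWithinAt_right (hg.intervalIntegrable 0 u)
    (t := Set.Ioi u)
    (hm.stronglyMeasurable.stronglyMeasurableAtFilter)
    ((hg.continuousWithinAt_toNNReal u).mono Set.Ioi_subset_Ici_self)).mono Set.Ioi_subset_Ici_self

theorem IsCadlagPath.continuous_integral {g : ℝ≥0 → ℝ} (hg : IsCadlagPath g) :
    Continuous (fun v : ℝ => ∫ s in (0 : ℝ)..v, g s.toNNReal) :=
  intervalIntegral.continuous_primitive (fun a b => hg.intervalIntegrable a b) 0

/-! ### Exponential discounting along a path -/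

theorem hasDerivAt_exp_neg_mul (C u : ℝ) :
    HasDerivAt (fun u => Real.exp (-(C * u))) (-C * Real.exp (-(C * u))) u := by
  have := ((hasDerivAt_id u).const_mul C).neg.exp
  simpa [mul_comm] using this

/-- Keeping the factor C on the left avoids a division and covers C = 0. -/
theorem mul_integral_exp_neg_mul (C a b : ℝ) :
    C * ∫ u in a..b, Real.exp (-(C * u)) = Real.exp (-(C * a)) - Real.exp (-(C * b)) := by
  have h := intervalIntegral.integral_eq_sub_of_hasDerivAt (a := a) (b := b)
    (fun u _ => hasDerivAt_exp_neg_mul C u) (Continuous.intervalIntegrable (by fun_prop) a b)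
  rw [intervalIntegral.integral_const_mul] at h
  linarith

/-- The exponentially discounted Dynkin functional of a path stopped at `r ≤ t`. -/
theorem discounted_stopped_path_identity {y g : ℝ≥0 → ℝ} (hy : IsCadlagPath y)
    (hg : IsCadlagPath g) (C : ℝ) {s r t : ℝ≥0} (hsr : s ≤ r) (hrt : r ≤ t) (m : ℝ≥0 → ℝ)
    (hm : ∀ u, m u = y u - y 0 - ∫ v in (0 : ℝ)..u, g v.toNNReal) :
    Real.exp (-(C * t)) * m r - Real.exp (-(C * s)) * m s
        + C * ∫ u in (s : ℝ)..t, Real.exp (-(C * u)) * m (min u.toNNReal r)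
      = Real.exp (-(C * r)) * y r - Real.exp (-(C * s)) * y s
        + ∫ u in (s : ℝ)..r, Real.exp (-(C * u)) * (C * y u.toNNReal - g u.toNNReal) := by
  set A : ℝ → ℝ := fun v => ∫ s in (0 : ℝ)..v, g s.toNNReal with hA
  have hexp := hasDerivAt_exp_neg_mul C
  have hexpc : Continuous fun u : ℝ => Real.exp (-(C * u)) := by fun_prop
  have iy : ∀ a b, IntervalIntegrable (fun u : ℝ => Real.exp (-(C * u)) * y u.toNNReal) volume a b :=
    fun a b => (hy.intervalIntegrable a b).continuousOn_mul hexpc.continuousOn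
  have ig : ∀ a b, IntervalIntegrable (fun u : ℝ => Real.exp (-(C * u)) * g u.toNNReal) volume a b :=
    fun a b => (hg.intervalIntegrable a b).continuousOn_mul hexpc.continuousOn
  have iA : ∀ a b, IntervalIntegrable (fun u : ℝ => Real.exp (-(C * u)) * A u) volume a b :=
    fun a b => (hexpc.mul hg.continuous_integral).intervalIntegrable a b
  have ie : ∀ a b, IntervalIntegrable (fun u : ℝ => Real.exp (-(C * u))) volume a b :=
    fun a b => hexpc.intervalIntegrable a b
  have intexp := mul_integral_exp_neg_mul C
  -- Integration by parts for e^{-Cu}A(u). As `g` is only càdlàg, A has right derivatives only,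
  -- which is enough for the fundamental theorem of calculus.
  have intA : C * (∫ u in (s : ℝ)..r, Real.exp (-(C * u)) * A u)
      = (∫ u in (s : ℝ)..r, Real.exp (-(C * u)) * g u.toNNReal)
        - (Real.exp (-(C * r)) * A r - Real.exp (-(C * s)) * A s) := by
    have h := intervalIntegral.integral_eq_sub_of_hasDeriv_right
      (a := (s : ℝ)) (b := r) (f := fun u => Real.exp (-(C * u)) * A u)
      (f' := fun u => -C * (Real.exp (-(C * u)) * A u) + Real.exp (-(C * u)) * g u.toNNReal)
      (hexpc.mul hg.continuous_integral).continuousOn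
      (fun u _ => by
        have := (hexp u).hasDerivWithinAt (s := Set.Ioi u) |>.mul (hg.hasDerivWithinAt_integral u)
        refine this.congr_deriv ?_
        ring)
      (((iA _ _).const_mul (-C)).add (ig _ _))
    rw [intervalIntegral.integral_add ((iA _ _).const_mul (-C)) (ig _ _),
      intervalIntegral.integral_const_mul] at h
    linarith
  have e1 : ∫ u in (s : ℝ)..r, Real.exp (-(C * u)) * m (min u.toNNReal r)
      = (∫ u in (s : ℝ)..r, Real.exp (-(C * u)) * y u.toNNReal)
        - y 0 * (∫ u in (s : ℝ)..r, Real.exp (-(C * u)))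
        - ∫ u in (s : ℝ)..r, Real.exp (-(C * u)) * A u := by
    rw [← intervalIntegral.integral_const_mul, ← intervalIntegral.integral_sub (iy _ _)
      ((ie _ _).const_mul _), ← intervalIntegral.integral_sub ((iy _ _).sub ((ie _ _).const_mul _))
      (iA _ _)]
    refine intervalIntegral.integral_congr fun u hu => ?_
    rw [Set.uIcc_of_le (by exact_mod_cast hsr)] at hu
    have hu0 : 0 ≤ u := s.2.trans hu.1
    have h1 : min u.toNNReal r = u.toNNReal := min_eq_left (Real.toNNReal_le_iff_le_coe.2 hu.2)
    simp only [h1, hm, Real.coe_toNNReal u hu0, hA]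
    ring
  -- After r the stopped path is frozen at m r.
  have e2 : ∫ u in (r : ℝ)..t, Real.exp (-(C * u)) * m (min u.toNNReal r)
      = m r * ∫ u in (r : ℝ)..t, Real.exp (-(C * u)) := by
    rw [← intervalIntegral.integral_const_mul]
    refine intervalIntegral.integral_congr fun u hu => ?_
    rw [Set.uIcc_of_le (by exact_mod_cast hrt)] at hu
    have h1 : min u.toNNReal r = r := min_eq_right (NNReal.le_toNNReal_of_coe_le hu.1)
    simp only [h1]
    ring
  have i1 : IntervalIntegrable (fun u : ℝ => Real.exp (-(C * u)) * m (min u.toNNReal r))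
      volume s r := by
    refine (((iy s r).sub ((ie s r).const_mul (y 0))).sub (iA s r)).congr_ae ?_
    filter_upwards [ae_restrict_mem measurableSet_uIoc] with u hu
    rw [Set.uIoc_of_le (by exact_mod_cast hsr)] at hu
    have hu0 : 0 ≤ u := s.2.trans hu.1.le
    have h1 : min u.toNNReal r = u.toNNReal := min_eq_left (Real.toNNReal_le_iff_le_coe.2 hu.2)
    simp only [h1, hm, Real.coe_toNNReal u hu0, hA]
    ring
  have i2 : IntervalIntegrable (fun u : ℝ => Real.exp (-(C * u)) * m (min u.toNNReal r))
      volume r t := by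
    refine ((ie r t).mul_const (m r)).congr_ae ?_
    filter_upwards [ae_restrict_mem measurableSet_uIoc] with u hu
    rw [Set.uIoc_of_le (by exact_mod_cast hrt)] at hu
    have h1 : min u.toNNReal r = r := min_eq_right (NNReal.le_toNNReal_of_coe_le hu.1.le)
    simp only [h1]
  rw [← intervalIntegral.integral_add_adjacent_intervals i1 i2, e1, e2]
  have e3 : ∫ u in (s : ℝ)..r, Real.exp (-(C * u)) * (C * y u.toNNReal - g u.toNNReal)
      = C * (∫ u in (s : ℝ)..r, Real.exp (-(C * u)) * y u.toNNReal)
        - ∫ u in (s : ℝ)..r, Real.exp (-(C * u)) * g u.toNNReal := by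
    rw [← intervalIntegral.integral_const_mul,
      ← intervalIntegral.integral_sub ((iy _ _).const_mul _) (ig _ _)]
    refine intervalIntegral.integral_congr fun u _ => ?_
    ring
  rw [e3]
  have hmr : m r = y r - y 0 - A r := hm r
  have hms : m s = y s - y 0 - A s := hm s
  have x1 := intexp s r
  have x2 := intexp r t
  have hrt' : C * (m r * ∫ u in (r : ℝ)..t, Real.exp (-(C * u)))
      = m r * (Real.exp (-(C * r)) - Real.exp (-(C * t))) := by rw [← x2]; ring
  have hsr' : C * (y 0 * ∫ u in (s : ℝ)..r, Real.exp (-(C * u)))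
      = y 0 * (Real.exp (-(C * s)) - Real.exp (-(C * r))) := by rw [← x1]; ring
  have : ∀ a b c d : ℝ, C * (a - b - c + d) = C * a - C * b - C * c + C * d := by intros; ring
  rw [this, hrt', hsr', intA, hmr, hms]
  ring

/-! ### Capped stopping times -/

/-- The deterministic time `t` capped by the random time `σ`. -/
noncomputable def cappedTime (t : ℝ≥0) (σ : WithTop ℝ≥0) : ℝ≥0 := (min (t : WithTop ℝ≥0) σ).untopA

theorem WithTop.untopA_coe_eq (a : ℝ≥0) : ((a : ℝ≥0) : WithTop ℝ≥0).untopA = a :=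
  WithTop.untopD_coe _ _

theorem cappedTime_top (t : ℝ≥0) : cappedTime t ⊤ = t := by
  rw [cappedTime, min_top_right, WithTop.untopA_coe_eq]

theorem cappedTime_coe (t a : ℝ≥0) : cappedTime t (a : WithTop ℝ≥0) = min t a := by
  rw [cappedTime, ← WithTop.coe_min, WithTop.untopA_coe_eq]

theorem cappedTime_le (t : ℝ≥0) (σ : WithTop ℝ≥0) : cappedTime t σ ≤ t := by
  induction σ using WithTop.recTopCoe with
  | top => rw [cappedTime_top]
  | coe a => rw [cappedTime_coe]; exact min_le_left _ _

theorem lt_cappedTime_iff {a t : ℝ≥0} {σ : WithTop ℝ≥0} :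
    a < cappedTime t σ ↔ a < t ∧ (a : WithTop ℝ≥0) < σ := by
  induction σ using WithTop.recTopCoe with
  | top => rw [cappedTime_top]; exact ⟨fun h => ⟨h, WithTop.coe_lt_top a⟩, And.left⟩
  | coe b => rw [cappedTime_coe, lt_min_iff, WithTop.coe_lt_coe]

theorem cappedTime_eq_min {u t : ℝ≥0} (h : u ≤ t) (σ : WithTop ℝ≥0) :
    cappedTime u σ = min u (cappedTime t σ) := by
  induction σ using WithTop.recTopCoe with
  | top => rw [cappedTime_top, cappedTime_top, min_eq_left h]
  | coe a => rw [cappedTime_coe, cappedTime_coe, ← min_assoc, min_eq_left h]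

theorem cappedTime_of_le {t : ℝ≥0} {σ : WithTop ℝ≥0} (h : (t : WithTop ℝ≥0) ≤ σ) :
    cappedTime t σ = t := by
  rw [cappedTime, min_eq_left h, WithTop.untopA_coe_eq]

theorem eventually_cappedTime_eq {σ : ℕ → WithTop ℝ≥0} (h : Tendsto σ atTop (𝓝 ⊤)) (t : ℝ≥0) :
    ∀ᶠ n in atTop, cappedTime t (σ n) = t :=
  (h.eventually (lt_mem_nhds (WithTop.coe_lt_top t))).mono fun _ hn => cappedTime_of_le hn.le

/-! ### Localizing sequences, Fubini, and discounted martingales -/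

section

variable {Ω : Type*} {mΩ : MeasurableSpace Ω} {𝓕 : Filtration ℝ≥0 mΩ} {Q : Measure Ω}

theorem measurable_cappedTime {τ : Ω → WithTop ℝ≥0} (hτ : IsStoppingTime 𝓕 τ) (t : ℝ≥0) :
    Measurable fun ω => cappedTime t (τ ω) := by
  refine measurable_of_Ioi fun a => ?_
  have : (fun ω => cappedTime t (τ ω)) ⁻¹' Set.Ioi a = {_ω : Ω | a < t} ∩ {ω | (a : WithTop ℝ≥0) < τ ω} := by
    ext ω
    simp [lt_cappedTime_iff]
  rw [this]
  exact (MeasurableSet.const _).inter (𝓕.le a _ (hτ.measurableSet_gt a))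

/-- `Locally` multiplies by the indicator of {τ > 0} before stopping. Where τ = 0 the stopped value
is M 0 = 0, so the indicator changes nothing. -/
theorem stoppedProcess_indicator_eq {M : ℝ≥0 → Ω → ℝ} (hM : ∀ ω, M 0 ω = 0)
    (τ : Ω → WithTop ℝ≥0) :
    stoppedProcess (fun i => {ω | ⊥ < τ ω}.indicator (M i)) τ
      = fun t ω => M (cappedTime t (τ ω)) ω := by
  funext t ω
  change {ω | ⊥ < τ ω}.indicator (M (cappedTime t (τ ω))) ω = _
  by_cases h : ⊥ < τ ω
  · exact Set.indicator_of_mem (s := {ω | ⊥ < τ ω}) h _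
  · rw [Set.indicator_of_notMem (s := {ω | ⊥ < τ ω}) h]
    have h0 : τ ω = ((0 : ℝ≥0) : WithTop ℝ≥0) := by simpa using h
    rw [h0, cappedTime_coe, min_eq_right zero_le, hM]

/-- A local martingale starting at zero has a localizing sequence of stopping times along which
the stopped processes are martingales. -/
theorem IsLocalMartingale.exists_localizing {M : ℝ≥0 → Ω → ℝ} (h : IsLocalMartingale 𝓕 Q M)
    (hM : ∀ ω, M 0 ω = 0) :
    ∃ τ : ℕ → Ω → WithTop ℝ≥0, (∀ n, IsStoppingTime 𝓕 (τ n)) ∧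
      (∀ᵐ ω ∂Q, Tendsto (τ · ω) atTop (𝓝 ⊤)) ∧
      ∀ n, Martingale (fun t ω => M (cappedTime t (τ n ω)) ω) 𝓕 Q := by
  obtain ⟨τ, hτ, hmart⟩ := h.2
  exact ⟨τ, hτ.isStoppingTime, hτ.tendsto_top, fun n => by
    simpa only [stoppedProcess_indicator_eq hM] using hmart n⟩

/-- Fubini on a bounded time interval for a jointly measurable process with bounded first
moments. -/
theorem integrable_prod_of_moment_bound [IsFiniteMeasure Q] {Z : ℝ≥0 → Ω → ℝ}
    (hZ : Measurable (Function.uncurry Z)) {a b : ℝ} {K : ℝ}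
    (hint : ∀ u : ℝ≥0, u ≤ b → Integrable (Z u) Q) (hK : ∀ u : ℝ≥0, u ≤ b → ∫ ω, ‖Z u ω‖ ∂Q ≤ K)
    (hb : 0 ≤ b) :
    Integrable (fun p : ℝ × Ω => Z p.1.toNNReal p.2) ((volume.restrict (Set.Ioc a b)).prod Q) := by
  have hm : Measurable (fun p : ℝ × Ω => Z p.1.toNNReal p.2) :=
    hZ.comp ((measurable_real_toNNReal.comp measurable_fst).prodMk measurable_snd)
  have hle : ∀ u ∈ Set.Ioc a b, ((u.toNNReal : ℝ≥0) : ℝ) ≤ b := fun u hu => by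
    simp [hu.2, hb]
  refine (integrable_prod_iff hm.aestronglyMeasurable).2 ⟨?_, ?_⟩
  · filter_upwards [ae_restrict_mem measurableSet_Ioc] with u hu using hint _ (hle u hu)
  · refine Integrable.mono' (integrable_const K) ?_ ?_
    · exact (hm.stronglyMeasurable.norm.integral_prod_right).aestronglyMeasurable
    · filter_upwards [ae_restrict_mem measurableSet_Ioc] with u hu
      rw [Real.norm_of_nonneg (by positivity)]
      exact hK _ (hle u hu)

theorem integrable_intervalIntegral_of_moment_bound [IsFiniteMeasure Q] {Z : ℝ≥0 → Ω → ℝ}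
    (hZ : Measurable (Function.uncurry Z)) {a b : ℝ} {K : ℝ}
    (hint : ∀ u : ℝ≥0, u ≤ b → Integrable (Z u) Q) (hK : ∀ u : ℝ≥0, u ≤ b → ∫ ω, ‖Z u ω‖ ∂Q ≤ K)
    (hb : 0 ≤ b) (hab : a ≤ b) :
    Integrable (fun ω => ∫ u in a..b, Z u.toNNReal ω) Q := by
  simp_rw [intervalIntegral.integral_of_le hab]
  exact (integrable_prod_of_moment_bound hZ hint hK hb).integral_prod_right

theorem integral_intervalIntegral_swap_of_moment_bound [IsFiniteMeasure Q] {Z : ℝ≥0 → Ω → ℝ}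
    (hZ : Measurable (Function.uncurry Z)) {a b : ℝ} {K : ℝ}
    (hint : ∀ u : ℝ≥0, u ≤ b → Integrable (Z u) Q) (hK : ∀ u : ℝ≥0, u ≤ b → ∫ ω, ‖Z u ω‖ ∂Q ≤ K)
    (hb : 0 ≤ b) (hab : a ≤ b) :
    ∫ ω, (∫ u in a..b, Z u.toNNReal ω) ∂Q = ∫ u in a..b, ∫ ω, Z u.toNNReal ω ∂Q := by
  simp_rw [intervalIntegral.integral_of_le hab]
  exact (integral_integral_swap (f := fun (u : ℝ) ω => Z u.toNNReal ω)
    (integrable_prod_of_moment_bound hZ hint hK hb)).symm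

theorem intervalIntegrable_integral_of_moment_bound [IsFiniteMeasure Q] {Z : ℝ≥0 → Ω → ℝ}
    (hZ : Measurable (Function.uncurry Z)) {a b : ℝ} {K : ℝ}
    (hint : ∀ u : ℝ≥0, u ≤ b → Integrable (Z u) Q) (hK : ∀ u : ℝ≥0, u ≤ b → ∫ ω, ‖Z u ω‖ ∂Q ≤ K)
    (hb : 0 ≤ b) (hab : a ≤ b) :
    IntervalIntegrable (fun u : ℝ => ∫ ω, Z u.toNNReal ω ∂Q) volume a b :=
  (intervalIntegrable_iff_integrableOn_Ioc_of_le hab).2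
    (integrable_prod_of_moment_bound hZ hint hK hb).integral_prod_left

/-- A bounded weight known at time `s` does not see the increments of a martingale after `s`. -/
theorem MeasureTheory.Martingale.integral_weight_mul_eq [IsFiniteMeasure Q] {N : ℝ≥0 → Ω → ℝ}
    (hN : Martingale N 𝓕 Q) {s u : ℝ≥0} (hsu : s ≤ u) {w : Ω → ℝ}
    (hw : StronglyMeasurable[𝓕 s] w) (hw1 : ∀ ω, ‖w ω‖ ≤ 1) :
    ∫ ω, w ω * N u ω ∂Q = ∫ ω, w ω * N s ω ∂Q := by
  have hi : Integrable (w * N u) Q :=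
    (hN.integrable u).bdd_mul (hw.mono (𝓕.le s)).aestronglyMeasurable (ae_of_all _ hw1)
  have h := condExp_mul_of_stronglyMeasurable_left hw hi (hN.integrable u)
  calc ∫ ω, w ω * N u ω ∂Q = ∫ ω, (Q[w * N u | 𝓕 s]) ω ∂Q := (integral_condExp (𝓕.le s)).symm
    _ = _ := integral_congr_ae (by
      filter_upwards [h, hN.condExp_ae_eq hsu] with ω h1 h2
      rw [h1, Pi.mul_apply, h2])

/-- Conditional Jensen. It supplies the uniform first-moment bound that Fubini on [s, t] requires.
-/
theorem MeasureTheory.Martingale.integral_norm_le [IsFiniteMeasure Q] {N : ℝ≥0 → Ω → ℝ}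
    (hN : Martingale N 𝓕 Q) {u t : ℝ≥0} (hut : u ≤ t) :
    ∫ ω, ‖N u ω‖ ∂Q ≤ ∫ ω, ‖N t ω‖ ∂Q := by
  calc ∫ ω, ‖N u ω‖ ∂Q = ∫ ω, |(Q[N t | 𝓕 u]) ω| ∂Q := integral_congr_ae (by
        filter_upwards [hN.condExp_ae_eq hut] with ω h
        rw [h, Real.norm_eq_abs])
    _ ≤ _ := integral_abs_condExp_le (N t)

/-- The discounted functional `e^{-Ct} N_t - e^{-Cs} N_s + C ∫ₛᵗ e^{-Cu} N_u du` of a martingale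
has zero mean against weights known at time `s`. -/
theorem MeasureTheory.Martingale.integral_discounted_eq_zero [IsFiniteMeasure Q]
    {N : ℝ≥0 → Ω → ℝ} (hN : Martingale N 𝓕 Q) (hNm : Measurable (Function.uncurry N))
    {s t : ℝ≥0} (hst : s ≤ t) {w : Ω → ℝ}
    (hw : StronglyMeasurable[𝓕 s] w) (hw1 : ∀ ω, ‖w ω‖ ≤ 1) {C : ℝ} (hC : 0 ≤ C) :
    Integrable (fun ω => w ω * (Real.exp (-(C * t)) * N t ω - Real.exp (-(C * s)) * N s ω
        + C * ∫ u in (s : ℝ)..t, Real.exp (-(C * u)) * N u.toNNReal ω)) Q ∧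
      ∫ ω, w ω * (Real.exp (-(C * t)) * N t ω - Real.exp (-(C * s)) * N s ω
        + C * ∫ u in (s : ℝ)..t, Real.exp (-(C * u)) * N u.toNNReal ω) ∂Q = 0 := by
  have hwm : StronglyMeasurable w := hw.mono (𝓕.le s)
  have hwN : ∀ u, Integrable (fun ω => w ω * N u ω) Q := fun u =>
    (hN.integrable u).bdd_mul hwm.aestronglyMeasurable (ae_of_all _ hw1)
  set Z : ℝ≥0 → Ω → ℝ := fun u ω => Real.exp (-(C * u)) * (w ω * N u ω) with hZ
  have hZm : Measurable (Function.uncurry Z) := by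
    have h1 : Measurable fun p : ℝ≥0 × Ω => Real.exp (-(C * (p.1 : ℝ))) := by fun_prop
    exact h1.mul ((hwm.measurable.comp measurable_snd).mul hNm)
  have hZi : ∀ u : ℝ≥0, (u : ℝ) ≤ (t : ℝ) → Integrable (Z u) Q := fun u _ => (hwN u).const_mul _
  have hZK : ∀ u : ℝ≥0, (u : ℝ) ≤ (t : ℝ) → ∫ ω, ‖Z u ω‖ ∂Q ≤ ∫ ω, ‖N t ω‖ ∂Q := fun u hu => by
    refine le_trans (integral_mono (hZi u hu).norm (hN.integrable u).norm fun ω => ?_)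
      (hN.integral_norm_le (by exact_mod_cast hu))
    have h1 : ‖Real.exp (-(C * (u : ℝ)))‖ ≤ 1 := by
      rw [Real.norm_of_nonneg (Real.exp_pos _).le]
      exact Real.exp_le_one_iff.2 (by have := u.2; simp only [NNReal.val_eq_coe] at this; nlinarith [mul_nonneg hC this])
    simp only [hZ, norm_mul]
    calc _ ≤ 1 * (1 * ‖N u ω‖) := by gcongr; exact hw1 ω
      _ = _ := by ring
  have hst' : (s : ℝ) ≤ t := by exact_mod_cast hst
  have hI := integrable_intervalIntegral_of_moment_bound hZm hZi hZK t.2 hst'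
  have hS := integral_intervalIntegral_swap_of_moment_bound hZm hZi hZK t.2 hst'
  have key : (fun ω => w ω * (Real.exp (-(C * t)) * N t ω - Real.exp (-(C * s)) * N s ω
        + C * ∫ u in (s : ℝ)..t, Real.exp (-(C * u)) * N u.toNNReal ω))
      = fun ω => Real.exp (-(C * t)) * (w ω * N t ω) - Real.exp (-(C * s)) * (w ω * N s ω)
        + C * ∫ u in (s : ℝ)..t, Z u.toNNReal ω := by
    funext ω
    have : ∫ u in (s : ℝ)..t, Z u.toNNReal ω
        = w ω * ∫ u in (s : ℝ)..t, Real.exp (-(C * u)) * N u.toNNReal ω := by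
      rw [← intervalIntegral.integral_const_mul]
      refine intervalIntegral.integral_congr fun u hu => ?_
      rw [Set.uIcc_of_le hst'] at hu
      simp only [hZ, Real.coe_toNNReal u (s.2.trans hu.1)]
      ring
    rw [this]
    ring
  rw [key]
  have i1 := ((hwN t).const_mul (Real.exp (-(C * t)))).sub ((hwN s).const_mul (Real.exp (-(C * s))))
  refine ⟨i1.add (hI.const_mul C), ?_⟩
  rw [integral_add (by exact i1) (hI.const_mul C), integral_sub ((hwN t).const_mul _) ((hwN s).const_mul _),
    integral_const_mul, integral_const_mul, integral_const_mul, hS,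
    hN.integral_weight_mul_eq hst hw hw1]
  -- Every E[wN_u] equals E[wN_s], so the discount factors combine to e^{-Ct} - e^{-Cs} + C∫ e^{-Cu}
  -- du = 0.
  have : ∫ u in (s : ℝ)..t, ∫ ω, Z u.toNNReal ω ∂Q
      = (∫ u in (s : ℝ)..t, Real.exp (-(C * u))) * ∫ ω, w ω * N s ω ∂Q := by
    rw [← intervalIntegral.integral_mul_const]
    refine intervalIntegral.integral_congr fun u hu => ?_
    rw [Set.uIcc_of_le hst'] at hu
    simp only [hZ, Real.coe_toNNReal u (s.2.trans hu.1), integral_const_mul]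
    rw [hN.integral_weight_mul_eq (NNReal.le_toNNReal_of_coe_le hu.1) hw hw1]
  rw [this, ← mul_assoc, mul_integral_exp_neg_mul]
  ring

end

/-! ### The discounted supermartingale inequality -/

section

variable {Ω : Type*} {mΩ : MeasurableSpace Ω} {𝓕 : Filtration ℝ≥0 mΩ} {Q : Measure Ω}

theorem measurable_uncurry_cappedTime {τ : Ω → WithTop ℝ≥0} (hτ : IsStoppingTime 𝓕 τ) :
    Measurable fun p : ℝ≥0 × Ω => cappedTime p.1 (τ p.2) :=
  ((measurable_fst.withTop_coe).min (hτ.measurable'.comp measurable_snd)).untopA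

theorem measurable_uncurry_of_adapted_cadlag {Y : ℝ≥0 → Ω → ℝ} (hY : StronglyAdapted 𝓕 Y)
    (hYc : ∀ ω, IsCadlagPath fun t => Y t ω) : Measurable (Function.uncurry Y) :=
  measurable_uncurry_of_rightContinuous (fun t => ((hY t).mono (𝓕.le t)).measurable)
    fun ω t => (hYc ω t).1

theorem measurable_integral_of_adapted_cadlag {g : ℝ≥0 → Ω → ℝ} (hg : StronglyAdapted 𝓕 g)
    (hgc : ∀ ω, IsCadlagPath fun t => g t ω) :
    Measurable fun p : ℝ≥0 × Ω => ∫ v in (0 : ℝ)..p.1, g v.toNNReal p.2 := by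
  refine measurable_uncurry_of_rightContinuous
    (Y := fun (t : ℝ≥0) ω => ∫ v in (0 : ℝ)..t, g v.toNNReal ω) (fun t => ?_) fun ω t => ?_
  · have hm : Measurable (fun p : ℝ × Ω => g p.1.toNNReal p.2) :=
      (measurable_uncurry_of_adapted_cadlag hg hgc).comp
        ((measurable_real_toNNReal.comp measurable_fst).prodMk measurable_snd)
    simp only [intervalIntegral.integral_of_le (NNReal.coe_nonneg t)]
    exact (hm.comp measurable_swap).stronglyMeasurable.integral_prod_right'.measurable
  · exact ((hgc ω).continuous_integral.comp NNReal.continuous_coe).continuousWithinAt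

/-- One localized step of the discounted supermartingale inequality. -/
theorem lintegral_discounted_stopped_le [IsFiniteMeasure Q] {Y g : ℝ≥0 → Ω → ℝ}
    (hY : StronglyAdapted 𝓕 Y) (hYc : ∀ ω, IsCadlagPath fun t => Y t ω)
    (hg : StronglyAdapted 𝓕 g) (hgc : ∀ ω, IsCadlagPath fun t => g t ω)
    {C : ℝ} (hC : 0 ≤ C) (hY0 : ∀ t ω, 0 ≤ Y t ω) (hgY : ∀ t ω, g t ω ≤ C * Y t ω)
    {τ : Ω → WithTop ℝ≥0} (hτ : IsStoppingTime 𝓕 τ)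
    (hM : Martingale (fun t ω => Y (cappedTime t (τ ω)) ω - Y 0 ω
      - ∫ v in (0 : ℝ)..cappedTime t (τ ω), g v.toNNReal ω) 𝓕 Q)
    {s t : ℝ≥0} (hst : s ≤ t) {w : Ω → ℝ} (hw : StronglyMeasurable[𝓕 s] w)
    (hw0 : ∀ ω, 0 ≤ w ω) (hw1 : ∀ ω, w ω ≤ 1) :
    ∫⁻ ω, ENNReal.ofReal ({ω | (s : WithTop ℝ≥0) < τ ω}.indicator w ω
        * (Real.exp (-(C * cappedTime t (τ ω))) * Y (cappedTime t (τ ω)) ω)) ∂Q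
      ≤ ∫⁻ ω, ENNReal.ofReal (w ω * (Real.exp (-(C * s)) * Y s ω)) ∂Q := by
  set N : ℝ≥0 → Ω → ℝ := fun t ω => Y (cappedTime t (τ ω)) ω - Y 0 ω
      - ∫ v in (0 : ℝ)..cappedTime t (τ ω), g v.toNNReal ω with hN
  -- The weight is restricted to {s < τ}, which belongs to 𝓕ₛ. Where τ ≤ s, the process has stopped
  -- by time s and Y_τ is not comparable with Y_s.
  set v : Ω → ℝ := {ω | (s : WithTop ℝ≥0) < τ ω}.indicator w with hv
  have hv0 : ∀ ω, 0 ≤ v ω := fun ω => Set.indicator_nonneg (fun ω _ => hw0 ω) ω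
  have hvw : ∀ ω, v ω ≤ w ω := fun ω => Set.indicator_le_self' (fun ω _ => hw0 ω) ω
  have hvm : StronglyMeasurable[𝓕 s] v := hw.indicator (hτ.measurableSet_gt s)
  have hv1 : ∀ ω, ‖v ω‖ ≤ 1 := fun ω => by
    rw [Real.norm_of_nonneg (hv0 ω)]
    exact (hvw ω).trans (hw1 ω)
  have hYm := measurable_uncurry_of_adapted_cadlag hY hYc
  have hτm := measurable_uncurry_cappedTime hτ
  have hNm : Measurable (Function.uncurry N) :=
    ((hYm.comp (hτm.prodMk measurable_snd)).sub
      (((hY 0).mono (𝓕.le 0)).measurable.comp measurable_snd)).sub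
      ((measurable_integral_of_adapted_cadlag hg hgc).comp (hτm.prodMk measurable_snd))
  obtain ⟨hDi, hD0⟩ := hM.integral_discounted_eq_zero hNm hst hvm hv1 hC
  set D : Ω → ℝ := fun ω => v ω * (Real.exp (-(C * t)) * N t ω - Real.exp (-(C * s)) * N s ω
        + C * ∫ u in (s : ℝ)..t, Real.exp (-(C * u)) * N u.toNNReal ω) with hD
  set a : Ω → ℝ := fun ω => v ω
        * (Real.exp (-(C * cappedTime t (τ ω))) * Y (cappedTime t (τ ω)) ω) with ha
  set b : Ω → ℝ := fun ω => v ω * (Real.exp (-(C * s)) * Y s ω) with hb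
  have hb0 : ∀ ω, 0 ≤ b ω := fun ω => mul_nonneg (hv0 ω) (mul_nonneg (Real.exp_pos _).le (hY0 _ _))
  have ha0 : ∀ ω, 0 ≤ a ω := fun ω => mul_nonneg (hv0 ω) (mul_nonneg (Real.exp_pos _).le (hY0 _ _))
  -- By the path identity, b + D - a is v times the integral of e^{-Cu}(CY - g) up to the capped
  -- time, which is nonnegative by the drift bound; D has mean zero.
  have hab : ∀ ω, a ω ≤ b ω + D ω := by
    intro ω
    by_cases hω : (s : WithTop ℝ≥0) < τ ω
    · set r := cappedTime t (τ ω) with hr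
      have hrt : r ≤ t := cappedTime_le _ _
      have hsr : s ≤ r := by
        rw [hr, ← cappedTime_of_le hω.le]
        rw [cappedTime_eq_min hst]
        exact min_le_right _ _
      have hid := discounted_stopped_path_identity (hYc ω) (hgc ω) C hsr hrt
        (fun u => Y u ω - Y 0 ω - ∫ v in (0 : ℝ)..u, g v.toNNReal ω) (fun _ => rfl)
      have e1 : N t ω = Y r ω - Y 0 ω - ∫ v in (0 : ℝ)..r, g v.toNNReal ω := rfl
      have e2 : N s ω = Y s ω - Y 0 ω - ∫ v in (0 : ℝ)..s, g v.toNNReal ω := by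
        simp only [hN, cappedTime_of_le hω.le]
      have e3 : ∫ u in (s : ℝ)..t, Real.exp (-(C * u)) * N u.toNNReal ω
          = ∫ u in (s : ℝ)..t, Real.exp (-(C * u)) * (Y (min u.toNNReal r) ω - Y 0 ω
            - ∫ v in (0 : ℝ)..(min u.toNNReal r : ℝ≥0), g v.toNNReal ω) := by
        refine intervalIntegral.integral_congr fun u hu => ?_
        rw [Set.uIcc_of_le (by exact_mod_cast hst)] at hu
        simp only [hN]
        rw [cappedTime_eq_min (Real.toNNReal_le_iff_le_coe.2 hu.2)]
      have hpos : 0 ≤ ∫ u in (s : ℝ)..r,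
          Real.exp (-(C * u)) * (C * Y u.toNNReal ω - g u.toNNReal ω) :=
        intervalIntegral.integral_nonneg (by exact_mod_cast hsr) fun u _ =>
          mul_nonneg (Real.exp_pos _).le (sub_nonneg.2 (hgY _ _))
      simp only [ha, hb, hD]
      rw [e1, e2, e3, hid, ← mul_add]
      refine mul_le_mul_of_nonneg_left ?_ (hv0 ω)
      linarith
    · have : v ω = 0 := Set.indicator_of_notMem (s := {ω | (s : WithTop ℝ≥0) < τ ω}) hω _
      simp [ha, hb, hD, this]
  have hbm : Measurable b := by
    exact (hvm.mono (𝓕.le s)).measurable.mul (((hY s).mono (𝓕.le s)).measurable.const_mul _)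
  have h1 : ∫⁻ ω, ENNReal.ofReal (a ω) ∂Q ≤ ∫⁻ ω, ENNReal.ofReal (b ω) ∂Q := by
    -- Integrability of b is not assumed: if its integral is infinite the bound is trivial,
    -- otherwise b + D can be integrated term by term.
    by_cases hfin : ∫⁻ ω, ENNReal.ofReal (b ω) ∂Q = ⊤
    · rw [hfin]; exact le_top
    · have hbi : Integrable b Q := (lintegral_ofReal_ne_top_iff_integrable
        hbm.aestronglyMeasurable (ae_of_all _ hb0)).1 hfin
      calc ∫⁻ ω, ENNReal.ofReal (a ω) ∂Q ≤ ∫⁻ ω, ENNReal.ofReal (b ω + D ω) ∂Q :=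
            lintegral_mono fun ω => ENNReal.ofReal_le_ofReal (hab ω)
        _ = ENNReal.ofReal (∫ ω, (b ω + D ω) ∂Q) := by
            exact (ofReal_integral_eq_lintegral_ofReal (hbi.add hDi)
              (ae_of_all _ fun ω => (ha0 ω).trans (hab ω))).symm
        _ = ENNReal.ofReal (∫ ω, b ω ∂Q) := by
            rw [integral_add hbi hDi, hD0, add_zero]
        _ = _ := ofReal_integral_eq_lintegral_ofReal hbi (ae_of_all _ hb0)
  refine h1.trans (lintegral_mono fun ω => ENNReal.ofReal_le_ofReal ?_)
  exact mul_le_mul_of_nonneg_right (hvw ω) (mul_nonneg (Real.exp_pos _).le (hY0 _ _))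

/-- If the drift of a nonnegative process is at most `C` times the process, then
`e^{-Ct} Y_t` is a supermartingale (without any integrability assumption). -/
theorem lintegral_discounted_le [IsFiniteMeasure Q] {Y g : ℝ≥0 → Ω → ℝ}
    (hY : StronglyAdapted 𝓕 Y) (hYc : ∀ ω, IsCadlagPath fun t => Y t ω)
    (hg : StronglyAdapted 𝓕 g) (hgc : ∀ ω, IsCadlagPath fun t => g t ω)
    {C : ℝ} (hC : 0 ≤ C) (hY0 : ∀ t ω, 0 ≤ Y t ω) (hgY : ∀ t ω, g t ω ≤ C * Y t ω)
    (hM : IsLocalMartingale 𝓕 Q fun t ω => Y t ω - Y 0 ω - ∫ v in (0 : ℝ)..t, g v.toNNReal ω)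
    {s t : ℝ≥0} (hst : s ≤ t) {w : Ω → ℝ} (hw : StronglyMeasurable[𝓕 s] w)
    (hw0 : ∀ ω, 0 ≤ w ω) (hw1 : ∀ ω, w ω ≤ 1) :
    ∫⁻ ω, ENNReal.ofReal (w ω * (Real.exp (-(C * t)) * Y t ω)) ∂Q
      ≤ ∫⁻ ω, ENNReal.ofReal (w ω * (Real.exp (-(C * s)) * Y s ω)) ∂Q := by
  obtain ⟨τ, hτ, htop, hmart⟩ := hM.exists_localizing (by simp)
  have hYm := measurable_uncurry_of_adapted_cadlag hY hYc
  set F : ℕ → Ω → ENNReal := fun n ω =>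
    ENNReal.ofReal ({ω | (s : WithTop ℝ≥0) < τ n ω}.indicator w ω
        * (Real.exp (-(C * cappedTime t (τ n ω))) * Y (cappedTime t (τ n ω)) ω)) with hF
  have hFm : ∀ n, Measurable (F n) := fun n => by
    have hc := measurable_cappedTime (hτ n) t
    have hw' : Measurable ({ω | (s : WithTop ℝ≥0) < τ n ω}.indicator w) :=
      (hw.mono (𝓕.le s)).measurable.indicator (𝓕.le s _ ((hτ n).measurableSet_gt s))
    have hYc' : Measurable fun ω => Y (cappedTime t (τ n ω)) ω :=
      hYm.comp (hc.prodMk measurable_id)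
    have he : Measurable fun ω => Real.exp (-(C * cappedTime t (τ n ω))) := by fun_prop
    exact (hw'.mul (he.mul hYc')).ennreal_ofReal
  -- Fatou: almost surely `F n ω` is eventually constant in n, because the capped time reaches t and
  -- the indicator becomes one.
  calc ∫⁻ ω, ENNReal.ofReal (w ω * (Real.exp (-(C * t)) * Y t ω)) ∂Q
      = ∫⁻ ω, liminf (fun n => F n ω) atTop ∂Q := by
        refine lintegral_congr_ae ?_
        filter_upwards [htop] with ω hω
        refine (Tendsto.liminf_eq (tendsto_const_nhds.congr' ?_)).symm
        filter_upwards [eventually_cappedTime_eq hω t,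
          hω.eventually (lt_mem_nhds (WithTop.coe_lt_top s))] with n h1 h2
        simp only [hF, h1]
        rw [Set.indicator_of_mem (s := {ω | (s : WithTop ℝ≥0) < τ n ω}) h2]
    _ ≤ liminf (fun n => ∫⁻ ω, F n ω ∂Q) atTop := lintegral_liminf_le hFm
    _ ≤ _ := by
        refine liminf_le_of_le (by isBoundedDefault) fun b hb => ?_
        obtain ⟨n, hn⟩ := hb.exists
        exact hn.trans (lintegral_discounted_stopped_le hY hYc hg hgc hC hY0 hgY (hτ n) (hmart n)
          hst hw hw0 hw1)

end

/-! ### Optional stopping by discretization -/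

theorem le_cappedTime_iff {a t : ℝ≥0} {σ : WithTop ℝ≥0} :
    a ≤ cappedTime t σ ↔ a ≤ t ∧ (a : WithTop ℝ≥0) ≤ σ := by
  induction σ using WithTop.recTopCoe with
  | top => rw [cappedTime_top]; exact ⟨fun h => ⟨h, le_top⟩, And.left⟩
  | coe b => rw [cappedTime_coe, le_min_iff, WithTop.coe_le_coe]

section

variable {Ω : Type*} {mΩ : MeasurableSpace Ω} {𝓕 : Filtration ℝ≥0 mΩ} {Q : Measure Ω}

/-- Optional stopping for nonnegative right-continuous supermartingales, in weighted form. -/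
theorem lintegral_weight_mul_cappedTime_le {S : ℝ≥0 → Ω → ℝ}
    (hSm : Measurable (Function.uncurry S))
    (hSc : ∀ ω t, ContinuousWithinAt (fun t => S t ω) (Set.Ici t) t)
    (hsuper : ∀ s t : ℝ≥0, s ≤ t → ∀ w : Ω → ℝ, StronglyMeasurable[𝓕 s] w → (∀ ω, 0 ≤ w ω) →
      (∀ ω, w ω ≤ 1) →
      ∫⁻ ω, ENNReal.ofReal (w ω * S t ω) ∂Q ≤ ∫⁻ ω, ENNReal.ofReal (w ω * S s ω) ∂Q)
    {w : Ω → ℝ} (hw : StronglyMeasurable[𝓕 0] w) (hw0 : ∀ ω, 0 ≤ w ω) (hw1 : ∀ ω, w ω ≤ 1)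
    {τ : Ω → WithTop ℝ≥0} (hτ : IsStoppingTime 𝓕 τ) (t : ℝ≥0) :
    ∫⁻ ω, ENNReal.ofReal (w ω * S (cappedTime t (τ ω)) ω) ∂Q
      ≤ ∫⁻ ω, ENNReal.ofReal (w ω * S 0 ω) ∂Q := by
  -- κ n / (n + 1) is the first grid point strictly after the capped time. Rounding strictly upwards
  -- makes {j < κ} the event that the capped time is at least j/(n+1), which is known at that grid
  -- time.
  set κ : ℕ → Ω → ℕ := fun n ω => ⌊((n : ℝ≥0) + 1) * cappedTime t (τ ω)⌋₊ + 1 with hκ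
  have hcm := measurable_cappedTime hτ t
  have hκm : ∀ n, Measurable (κ n) := fun n =>
    (measurable_from_top (f := fun k : ℕ => k + 1)).comp
      (Nat.measurable_floor.comp (hcm.const_mul _))
  have hwm : Measurable w := (hw.mono (𝓕.le 0)).measurable
  have hlt : ∀ n j : ℕ, {ω | j < κ n ω}
      = {_ω : Ω | (j : ℝ≥0) / (n + 1) ≤ t} ∩
        {ω | (((j : ℝ≥0) / (n + 1) : ℝ≥0) : WithTop ℝ≥0) ≤ τ ω} := by
    intro n j
    ext ω
    have : j < κ n ω ↔ (j : ℝ≥0) / (n + 1) ≤ cappedTime t (τ ω) := by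
      rw [hκ, Nat.lt_add_one_iff, Nat.le_floor_iff zero_le, div_le_iff₀ (by positivity), mul_comm]
    exact this.trans le_cappedTime_iff
  have hA : ∀ n j : ℕ, MeasurableSet[𝓕 ((j : ℝ≥0) / (n + 1))] {ω | j < κ n ω} := fun n j => by
    rw [hlt]
    exact (MeasurableSet.const _).inter (hτ.measurableSet_ge _)
  -- Discrete optional stopping: passing from j to j + 1 changes the process only on {j < κ}, where
  -- the supermartingale inequality applies with the weight w times the indicator of this event.
  have hstep : ∀ n j : ℕ,
      ∫⁻ ω, ENNReal.ofReal (w ω * S (((min j (κ n ω) : ℕ) : ℝ≥0) / (n + 1)) ω) ∂Q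
        ≤ ∫⁻ ω, ENNReal.ofReal (w ω * S 0 ω) ∂Q := by
    intro n j
    induction j with
    | zero => simp
    | succ j ih =>
      refine le_trans ?_ ih
      have hA' := 𝓕.le _ _ (hA n j)
      rw [← lintegral_add_compl _ hA', ← lintegral_add_compl (fun ω => ENNReal.ofReal
        (w ω * S (((min j (κ n ω) : ℕ) : ℝ≥0) / (n + 1)) ω)) hA']
      refine add_le_add ?_ (le_of_eq ?_)
      · have hind : ∀ i : ℕ, (∀ ω, j < κ n ω → min i (κ n ω) = i) →
            ∫⁻ ω in {ω | j < κ n ω}, ENNReal.ofReal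
              (w ω * S (((min i (κ n ω) : ℕ) : ℝ≥0) / (n + 1)) ω) ∂Q
            = ∫⁻ ω, ENNReal.ofReal ({ω | j < κ n ω}.indicator w ω * S ((i : ℝ≥0) / (n + 1)) ω) ∂Q := by
          intro i hi
          rw [← lintegral_indicator hA']
          refine lintegral_congr fun ω => ?_
          by_cases h : j < κ n ω
          · rw [Set.indicator_of_mem (s := {ω | j < κ n ω}) h,
              Set.indicator_of_mem (s := {ω | j < κ n ω}) h, hi ω h]
          · rw [Set.indicator_of_notMem (s := {ω | j < κ n ω}) h,
              Set.indicator_of_notMem (s := {ω | j < κ n ω}) h]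
            simp
        rw [hind (j + 1) fun ω h => min_eq_left h, hind j fun ω h => min_eq_left h.le]
        refine hsuper _ _ (by gcongr; simp) _ ((hw.mono (𝓕.mono zero_le)).indicator (hA n j)) ?_ ?_
        · exact fun ω => Set.indicator_nonneg (fun ω _ => hw0 ω) ω
        · exact fun ω => (Set.indicator_le_self' (fun ω _ => hw0 ω) ω).trans (hw1 ω)
      · refine setLIntegral_congr_fun hA'.compl fun ω hω => ?_
        have h : κ n ω ≤ j := not_lt.1 hω
        simp only [min_eq_right h, min_eq_right (h.trans j.le_succ)]
  -- Since the capped time is at most t, κ is bounded and finitely many steps reach it.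
  have hstep' : ∀ n : ℕ,
      ∫⁻ ω, ENNReal.ofReal (w ω * S (((κ n ω : ℕ) : ℝ≥0) / (n + 1)) ω) ∂Q
        ≤ ∫⁻ ω, ENNReal.ofReal (w ω * S 0 ω) ∂Q := by
    intro n
    refine le_trans (le_of_eq (lintegral_congr fun ω => ?_))
      (hstep n (⌊((n : ℝ≥0) + 1) * t⌋₊ + 1))
    rw [min_eq_right]
    simp only [hκ]
    gcongr
    exact cappedTime_le _ _
  -- The grid times converge from the right to the capped time, so right-continuity and Fatou
  -- suffice.
  calc ∫⁻ ω, ENNReal.ofReal (w ω * S (cappedTime t (τ ω)) ω) ∂Q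
      = ∫⁻ ω, liminf (fun n : ℕ => ENNReal.ofReal (w ω * S (((κ n ω : ℕ) : ℝ≥0) / (n + 1)) ω))
          atTop ∂Q := by
        refine lintegral_congr fun ω => (Tendsto.liminf_eq ?_).symm
        exact (ENNReal.continuous_ofReal.tendsto _).comp
          (((hSc ω _).tendsto.comp (tendsto_floor_add_one_div (cappedTime t (τ ω)))).const_mul _)
    _ ≤ liminf (fun n : ℕ => ∫⁻ ω, ENNReal.ofReal
          (w ω * S (((κ n ω : ℕ) : ℝ≥0) / (n + 1)) ω) ∂Q) atTop := by
        refine lintegral_liminf_le fun n => ?_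
        have h1 : Measurable fun ω => ((κ n ω : ℕ) : ℝ≥0) / ((n : ℝ≥0) + 1) :=
          ((measurable_from_top (f := fun k : ℕ => (k : ℝ≥0))).comp (hκm n)).div_const _
        exact (hwm.mul (hSm.comp (h1.prodMk measurable_id))).ennreal_ofReal
    _ ≤ _ := by
        refine liminf_le_of_le (by isBoundedDefault) fun b hb => ?_
        obtain ⟨n, hn⟩ := hb.exists
        exact hn.trans (hstep' n)

/-- Weighted moments of a nonnegative process with drift at most `C` times the process, at a
stopping time capped at `t`. -/
theorem lintegral_weight_mul_stopped_le [IsFiniteMeasure Q] {Y g : ℝ≥0 → Ω → ℝ}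
    (hY : StronglyAdapted 𝓕 Y) (hYc : ∀ ω, IsCadlagPath fun t => Y t ω)
    (hg : StronglyAdapted 𝓕 g) (hgc : ∀ ω, IsCadlagPath fun t => g t ω)
    {C : ℝ} (hC : 0 ≤ C) (hY0 : ∀ t ω, 0 ≤ Y t ω) (hgY : ∀ t ω, g t ω ≤ C * Y t ω)
    (hM : IsLocalMartingale 𝓕 Q fun t ω => Y t ω - Y 0 ω - ∫ v in (0 : ℝ)..t, g v.toNNReal ω)
    {w : Ω → ℝ} (hw : StronglyMeasurable[𝓕 0] w) (hw0 : ∀ ω, 0 ≤ w ω) (hw1 : ∀ ω, w ω ≤ 1)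
    {τ : Ω → WithTop ℝ≥0} (hτ : IsStoppingTime 𝓕 τ) (t : ℝ≥0) :
    ∫⁻ ω, ENNReal.ofReal (w ω * Y (cappedTime t (τ ω)) ω) ∂Q
      ≤ ENNReal.ofReal (Real.exp (C * t)) * ∫⁻ ω, ENNReal.ofReal (w ω * Y 0 ω) ∂Q := by
  have hYm := measurable_uncurry_of_adapted_cadlag hY hYc
  have he : Measurable fun p : ℝ≥0 × Ω => Real.exp (-(C * (p.1 : ℝ))) := by fun_prop
  have h := lintegral_weight_mul_cappedTime_le (𝓕 := 𝓕) (Q := Q)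
    (S := fun t ω => Real.exp (-(C * t)) * Y t ω) (he.mul hYm)
    (fun ω t => ContinuousWithinAt.mul
      (Continuous.continuousWithinAt (by fun_prop)) (hYc ω t).1)
    (fun s t hst w hw hw0 hw1 => lintegral_discounted_le hY hYc hg hgc hC hY0 hgY hM hst hw hw0 hw1)
    hw hw0 hw1 hτ t
  simp only [NNReal.coe_zero, mul_zero, neg_zero, Real.exp_zero, one_mul] at h
  calc ∫⁻ ω, ENNReal.ofReal (w ω * Y (cappedTime t (τ ω)) ω) ∂Q
      ≤ ∫⁻ ω, ENNReal.ofReal (Real.exp (C * t)) * ENNReal.ofReal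
          (w ω * (Real.exp (-(C * cappedTime t (τ ω))) * Y (cappedTime t (τ ω)) ω)) ∂Q := by
        refine lintegral_mono fun ω => ?_
        rw [← ENNReal.ofReal_mul (Real.exp_pos _).le]
        refine ENNReal.ofReal_le_ofReal ?_
        have hle : ((cappedTime t (τ ω) : ℝ≥0) : ℝ) ≤ t := by exact_mod_cast cappedTime_le _ _
        have h1 : 1 ≤ Real.exp (C * t) * Real.exp (-(C * cappedTime t (τ ω))) := by
          rw [← Real.exp_add]
          exact Real.one_le_exp (by nlinarith)
        have h2 := mul_nonneg (hw0 ω) (hY0 (cappedTime t (τ ω)) ω)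
        nlinarith [mul_le_mul_of_nonneg_right h1 h2]
    _ = ENNReal.ofReal (Real.exp (C * t)) * ∫⁻ ω, ENNReal.ofReal
          (w ω * (Real.exp (-(C * cappedTime t (τ ω))) * Y (cappedTime t (τ ω)) ω)) ∂Q :=
        lintegral_const_mul' _ _ ENNReal.ofReal_ne_top
    _ ≤ _ := by gcongr

end

/-! ### Uniform integrability and removal of the localization -/

/-- Almost everywhere convergence together with bounded second moments implies convergence of the
integrals. -/
theorem tendsto_integral_of_sq_bound {α : Type*} {mα : MeasurableSpace α} {μ : Measure α}
    [IsFiniteMeasure μ] {f : ℕ → α → ℝ} {f' : α → ℝ} (hf : ∀ n, Measurable (f n))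
    (hf' : Integrable f' μ) {K : ENNReal} (hK : K ≠ ⊤)
    (hb : ∀ n, ∫⁻ x, ENNReal.ofReal (f n x ^ 2) ∂μ ≤ K)
    (hlim : ∀ᵐ x ∂μ, Tendsto (fun n => f n x) atTop (𝓝 (f' x))) :
    Tendsto (fun n => ∫ x, f n x ∂μ) atTop (𝓝 (∫ x, f' x ∂μ)) := by
  have hi : ∀ n, Integrable (f n) μ := fun n => by
    have h2 : Integrable (fun x => f n x ^ 2) μ :=
      (lintegral_ofReal_ne_top_iff_integrable ((hf n).pow_const 2).aestronglyMeasurable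
        (ae_of_all _ fun x => sq_nonneg _)).1 ((hb n).trans_lt hK.lt_top).ne
    refine (h2.add (integrable_const 1)).mono' (hf n).aestronglyMeasurable (ae_of_all _ fun x => ?_)
    simp only [Pi.add_apply, Real.norm_eq_abs]
    nlinarith [sq_nonneg (|f n x| - 1), sq_abs (f n x)]
  have hui : UnifIntegrable f 1 μ := by
    refine unifIntegrable_of le_rfl ENNReal.one_ne_top (fun n => (hf n).aestronglyMeasurable)
      fun ε hε => ?_
    have hεK : 0 < ε / (K.toReal + 1) := by positivity
    refine ⟨Real.toNNReal ((K.toReal + 1) / ε), fun n => ?_⟩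
    -- On {|f| ≥ c} one has |f| ≤ f²/c, so the tail is at most K/c = εK/(K+1) ≤ ε. The added 1 keeps
    -- c positive when K = 0.
    set c : ℝ := (K.toReal + 1) / ε with hc
    have hcpos : 0 < c := by positivity
    rw [eLpNorm_one_eq_lintegral_enorm]
    calc ∫⁻ x, ‖{x | c.toNNReal ≤ ‖f n x‖₊}.indicator (f n) x‖ₑ ∂μ
        ≤ ∫⁻ x, ENNReal.ofReal c⁻¹ * ENNReal.ofReal (f n x ^ 2) ∂μ := by
          refine lintegral_mono fun x => ?_
          by_cases hx : c.toNNReal ≤ ‖f n x‖₊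
          · rw [Set.indicator_of_mem (s := {x | c.toNNReal ≤ ‖f n x‖₊}) hx,
              ← ENNReal.ofReal_mul (by positivity), Real.enorm_eq_ofReal_abs]
            refine ENNReal.ofReal_le_ofReal ?_
            have hx' : c ≤ |f n x| := by
              have := Real.toNNReal_le_iff_le_coe.1 hx
              simpa using this
            rw [inv_mul_eq_div, le_div_iff₀ hcpos, ← sq_abs (f n x), sq]
            exact mul_le_mul_of_nonneg_left hx' (abs_nonneg _)
          · rw [Set.indicator_of_notMem (s := {x | c.toNNReal ≤ ‖f n x‖₊}) hx]
            simp
      _ = ENNReal.ofReal c⁻¹ * ∫⁻ x, ENNReal.ofReal (f n x ^ 2) ∂μ :=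
          lintegral_const_mul' _ _ ENNReal.ofReal_ne_top
      _ ≤ ENNReal.ofReal c⁻¹ * K := by gcongr; exact hb n
      _ = ENNReal.ofReal (c⁻¹ * K.toReal) := by
          rw [ENNReal.ofReal_mul (by positivity), ENNReal.ofReal_toReal hK]
      _ ≤ ENNReal.ofReal ε := by
          refine ENNReal.ofReal_le_ofReal ?_
          have hk : 0 ≤ K.toReal := ENNReal.toReal_nonneg
          rw [hc, inv_div, div_mul_eq_mul_div, div_le_iff₀ (by positivity)]
          nlinarith
  exact tendsto_integral_of_L1' f' hf'.aestronglyMeasurable (.of_forall hi)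
    (tendsto_Lp_finite_of_tendsto_ae le_rfl ENNReal.one_ne_top
      (fun n => (hf n).aestronglyMeasurable) (memLp_one_iff_integrable.2 hf') hui hlim)

section

variable {Ω : Type*} {mΩ : MeasurableSpace Ω} {𝓕 : Filtration ℝ≥0 mΩ} {Q : Measure Ω}

/-- Removing the localization: if the second moments at capped stopping times are bounded on a
set `A`, the expectation over `A ∩ B` of the stopped process converges. -/
theorem tendsto_setIntegral_stopped [IsFiniteMeasure Q] {Z h : ℝ≥0 → Ω → ℝ}
    (hZ : StronglyAdapted 𝓕 Z) (hZc : ∀ ω, IsCadlagPath fun t => Z t ω)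
    (hh : StronglyAdapted 𝓕 h) (hhc : ∀ ω, IsCadlagPath fun t => h t ω)
    (hZi : ∀ t, Integrable (Z t) Q) (hhi : ∀ t, Integrable (h t) Q)
    {u : ℝ≥0} {L : ℝ} (hL : ∀ v ≤ u, ∫ ω, ‖h v ω‖ ∂Q ≤ L)
    {τ : ℕ → Ω → WithTop ℝ≥0} (hτ : ∀ n, IsStoppingTime 𝓕 (τ n))
    (htop : ∀ᵐ ω ∂Q, Tendsto (τ · ω) atTop (𝓝 ⊤))
    {A : Set Ω} {K : ENNReal} (hK : K ≠ ⊤)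
    (hb : ∀ n, ∫⁻ ω in A, ENNReal.ofReal (Z (cappedTime u (τ n ω)) ω ^ 2) ∂Q ≤ K) :
    Tendsto (fun n => ∫ ω in A, (Z (cappedTime u (τ n ω)) ω - Z 0 ω
        - ∫ v in (0 : ℝ)..cappedTime u (τ n ω), h v.toNNReal ω) ∂Q) atTop
      (𝓝 (∫ ω in A, (Z u ω - Z 0 ω - ∫ v in (0 : ℝ)..u, h v.toNNReal ω) ∂Q)) := by
  have hZm := measurable_uncurry_of_adapted_cadlag hZ hZc
  have hhm := measurable_uncurry_of_adapted_cadlag hh hhc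
  have hIm := measurable_integral_of_adapted_cadlag hh hhc
  have hcm := fun n => measurable_cappedTime (hτ n) u
  have hbound : Integrable (fun ω => ∫ v in (0 : ℝ)..u, ‖h v.toNNReal ω‖) Q :=
    integrable_intervalIntegral_of_moment_bound (Z := fun t ω => ‖h t ω‖) (K := L) hhm.norm
      (fun v _ => (hhi v).norm) (fun v hv => by simpa using hL v (by exact_mod_cast hv)) u.2 u.2
  have hle : ∀ ω, ∀ c ≤ u, ‖∫ v in (0 : ℝ)..c, h v.toNNReal ω‖
      ≤ ∫ v in (0 : ℝ)..u, ‖h v.toNNReal ω‖ := fun ω c hc => by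
    refine (intervalIntegral.norm_integral_le_integral_norm c.2).trans ?_
    exact intervalIntegral.integral_mono_interval le_rfl c.2 (by exact_mod_cast hc)
      (ae_of_all _ fun v => norm_nonneg _) ((hhc ω).intervalIntegrable 0 u).norm
  have h2b : ∀ ω, ∀ c ≤ u, ‖Z 0 ω + ∫ v in (0 : ℝ)..c, h v.toNNReal ω‖
      ≤ ‖Z 0 ω‖ + ∫ v in (0 : ℝ)..u, ‖h v.toNNReal ω‖ := fun ω c hc =>
    (norm_add_le _ _).trans (by gcongr; exact hle ω c hc)
  have h2bi := ((hZi 0).norm.add hbound)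
  have hZcm : ∀ n, Measurable fun ω => Z (cappedTime u (τ n ω)) ω := fun n =>
    hZm.comp ((hcm n).prodMk measurable_id)
  have h2m : ∀ n, Measurable fun ω => Z 0 ω + ∫ v in (0 : ℝ)..cappedTime u (τ n ω),
      h v.toNNReal ω := fun n =>
    ((hZ 0).mono (𝓕.le 0)).measurable.add (hIm.comp ((hcm n).prodMk measurable_id))
  have h2m' : Measurable fun ω => Z 0 ω + ∫ v in (0 : ℝ)..u, h v.toNNReal ω :=
    ((hZ 0).mono (𝓕.le 0)).measurable.add (hIm.comp (measurable_const.prodMk measurable_id))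
  have h2i : ∀ n, Integrable (fun ω => Z 0 ω + ∫ v in (0 : ℝ)..cappedTime u (τ n ω),
      h v.toNNReal ω) Q := fun n =>
    h2bi.mono' (h2m n).aestronglyMeasurable (ae_of_all _ fun ω => h2b ω _ (cappedTime_le _ _))
  have h2i' : Integrable (fun ω => Z 0 ω + ∫ v in (0 : ℝ)..u, h v.toNNReal ω) Q :=
    h2bi.mono' h2m'.aestronglyMeasurable (ae_of_all _ fun ω => h2b ω _ le_rfl)
  have hev : ∀ᵐ ω ∂Q.restrict A, ∀ᶠ n in atTop, cappedTime u (τ n ω) = u := by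
    filter_upwards [ae_restrict_of_ae htop] with ω hω using eventually_cappedTime_eq hω u
  have hZi' : ∀ n, IntegrableOn (fun ω => Z (cappedTime u (τ n ω)) ω) A Q := fun n => by
    have h2 : Integrable (fun ω => Z (cappedTime u (τ n ω)) ω ^ 2) (Q.restrict A) :=
      (lintegral_ofReal_ne_top_iff_integrable ((hZcm n).pow_const 2).aestronglyMeasurable
        (ae_of_all _ fun x => sq_nonneg _)).1 ((hb n).trans_lt hK.lt_top).ne
    refine (h2.add (integrable_const 1)).mono' (hZcm n).aestronglyMeasurable
      (ae_of_all _ fun ω => ?_)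
    simp only [Pi.add_apply, Real.norm_eq_abs]
    nlinarith [sq_nonneg (|Z (cappedTime u (τ n ω)) ω| - 1), sq_abs (Z (cappedTime u (τ n ω)) ω)]
  -- The process at random times has no integrable majorant at hand; the second-moment bound
  -- replaces it. The remaining terms are dominated by |Z₀| + ∫₀ᵘ|h|.
  have t1 : Tendsto (fun n => ∫ ω in A, Z (cappedTime u (τ n ω)) ω ∂Q) atTop
      (𝓝 (∫ ω in A, Z u ω ∂Q)) := by
    refine tendsto_integral_of_sq_bound hZcm (hZi u).integrableOn hK hb ?_
    filter_upwards [hev] with ω hω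
    exact tendsto_const_nhds.congr' (hω.mono fun n hn => by simp only [hn])
  have t2 : Tendsto (fun n => ∫ ω in A, (Z 0 ω + ∫ v in (0 : ℝ)..cappedTime u (τ n ω),
      h v.toNNReal ω) ∂Q) atTop (𝓝 (∫ ω in A, (Z 0 ω + ∫ v in (0 : ℝ)..u, h v.toNNReal ω) ∂Q)) := by
    refine tendsto_integral_of_dominated_convergence _ (fun n => (h2m n).aestronglyMeasurable)
      h2bi.integrableOn (fun n => ae_of_all _ fun ω => h2b ω _ (cappedTime_le _ _)) ?_
    filter_upwards [hev] with ω hω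
    exact tendsto_const_nhds.congr' (hω.mono fun n hn => by simp only [hn])
  have t3 := t1.sub t2
  rw [← integral_sub (hZi u).integrableOn h2i'.integrableOn] at t3
  simp only [sub_sub]
  refine t3.congr fun n => ?_
  rw [← integral_sub (hZi' n) (h2i n).integrableOn]

/-- A localized Dynkin formula: if `Z - Z₀ - ∫ h` is a local martingale, with second moments of `Z`
bounded at capped stopping times on each member of an increasing exhausting sequence of events
known at time zero, and with locally bounded first moments of `h`, then it is a martingale. -/
theorem setIntegral_eq_add_integral_drift [IsFiniteMeasure Q] {Z h : ℝ≥0 → Ω → ℝ}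
    (hZ : StronglyAdapted 𝓕 Z) (hZc : ∀ ω, IsCadlagPath fun t => Z t ω)
    (hh : StronglyAdapted 𝓕 h) (hhc : ∀ ω, IsCadlagPath fun t => h t ω)
    (hZi : ∀ t, Integrable (Z t) Q) (hhi : ∀ t, Integrable (h t) Q)
    (hL : ∀ u, ∃ L : ℝ, ∀ v ≤ u, ∫ ω, ‖h v ω‖ ∂Q ≤ L)
    (hM : IsLocalMartingale 𝓕 Q fun t ω => Z t ω - Z 0 ω - ∫ v in (0 : ℝ)..t, h v.toNNReal ω)
    {A : ℕ → Set Ω} (hA : ∀ m, MeasurableSet[𝓕 0] (A m)) (hAm : Monotone A)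
    (hAu : ⋃ m, A m = Set.univ)
    (hb : ∀ m u, ∃ K : ENNReal, K ≠ ⊤ ∧ ∀ τ, IsStoppingTime 𝓕 τ →
      ∫⁻ ω in A m, ENNReal.ofReal (Z (cappedTime u (τ ω)) ω ^ 2) ∂Q ≤ K)
    {s t : ℝ≥0} (hst : s ≤ t) {B : Set Ω} (hB : MeasurableSet[𝓕 s] B) :
    ∫ ω in B, Z t ω ∂Q = ∫ ω in B, Z s ω ∂Q
      + ∫ v in (s : ℝ)..t, ∫ ω in B, h v.toNNReal ω ∂Q := by
  obtain ⟨τ, hτ, htop, hmart⟩ := hM.exists_localizing (by simp)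
  have hhm := measurable_uncurry_of_adapted_cadlag hh hhc
  set M : ℝ≥0 → Ω → ℝ := fun t ω => Z t ω - Z 0 ω - ∫ v in (0 : ℝ)..t, h v.toNNReal ω with hMdef
  have hInt : ∀ u : ℝ≥0, Integrable (fun ω => ∫ v in (0 : ℝ)..u, h v.toNNReal ω) Q := fun u => by
    obtain ⟨L, hL⟩ := hL u
    exact integrable_intervalIntegral_of_moment_bound hhm (fun v _ => hhi v)
      (fun v hv => hL v (by exact_mod_cast hv)) u.2 u.2
  have hMi : ∀ u, Integrable (M u) Q := fun u => ((hZi u).sub (hZi 0)).sub (hInt u)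
  -- A m ∩ B lies in 𝓕ₛ, so the stopped martingales have equal integrals over it at s and t; both
  -- sides pass to the limit.
  have hAB : ∀ m, ∫ ω in A m ∩ B, M t ω ∂Q = ∫ ω in A m ∩ B, M s ω ∂Q := by
    intro m
    have hlim : ∀ u, Tendsto (fun n => ∫ ω in A m ∩ B, M (cappedTime u (τ n ω)) ω ∂Q) atTop
        (𝓝 (∫ ω in A m ∩ B, M u ω ∂Q)) := by
      intro u
      obtain ⟨K, hK, hbK⟩ := hb m u
      obtain ⟨L, hL⟩ := hL u
      exact tendsto_setIntegral_stopped hZ hZc hh hhc hZi hhi hL hτ htop hK fun n =>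
        (lintegral_mono_set Set.inter_subset_left).trans (hbK _ (hτ n))
    refine tendsto_nhds_unique ((hlim t).congr fun n => ?_) (hlim s)
    exact ((hmart n).setIntegral_eq hst (MeasurableSet.inter (𝓕.mono zero_le _ (hA m)) hB)).symm
  have hBm := 𝓕.le s _ hB
  -- M is integrable on the whole space, so the events A m can exhaust it without further bounds.
  have hMts : ∫ ω in B, M t ω ∂Q = ∫ ω in B, M s ω ∂Q := by
    have hlim : ∀ u, Tendsto (fun m => ∫ ω in A m ∩ B, M u ω ∂Q) atTop
        (𝓝 (∫ ω in B, M u ω ∂Q)) := by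
      intro u
      have h := tendsto_setIntegral_of_monotone (μ := Q) (f := M u) (s := fun m => A m ∩ B)
        (fun m => (𝓕.le 0 _ (hA m)).inter hBm)
        (fun i j hij => Set.inter_subset_inter_left _ (hAm hij)) (hMi u).integrableOn
      rwa [← Set.iUnion_inter, hAu, Set.univ_inter] at h
    exact tendsto_nhds_unique ((hlim t).congr hAB) (hlim s)
  obtain ⟨L, hL⟩ := hL t
  have hswap : ∫ ω in B, (∫ v in (s : ℝ)..t, h v.toNNReal ω) ∂Q
      = ∫ v in (s : ℝ)..t, ∫ ω in B, h v.toNNReal ω ∂Q :=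
    integral_intervalIntegral_swap_of_moment_bound (Q := Q.restrict B) (K := L) hhm
      (fun v _ => (hhi v).integrableOn)
      (fun v hv => (setIntegral_le_integral (hhi v).norm (ae_of_all _ fun _ => norm_nonneg _)).trans
        (hL v (by exact_mod_cast hv))) t.2 (by exact_mod_cast hst)
  have hd : ∫ ω in B, (M t ω - M s ω) ∂Q = 0 := by
    rw [integral_sub (hMi t).integrableOn (hMi s).integrableOn, hMts, sub_self]
  have he : ∀ ω, M t ω - M s ω = Z t ω - Z s ω - ∫ v in (s : ℝ)..t, h v.toNNReal ω := fun ω => by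
    have := intervalIntegral.integral_interval_sub_left ((hhc ω).intervalIntegrable 0 t)
      ((hhc ω).intervalIntegrable 0 s)
    simp only [hMdef, ← this]
    ring
  have hsI : Integrable (fun ω => ∫ v in (s : ℝ)..t, h v.toNNReal ω) Q :=
    integrable_intervalIntegral_of_moment_bound hhm (fun v _ => hhi v)
      (fun v hv => hL v (by exact_mod_cast hv)) t.2 (by exact_mod_cast hst)
  simp_rw [he] at hd
  rw [integral_sub (by exact ((hZi t).sub (hZi s)).integrableOn) hsI.integrableOn,
    integral_sub (hZi t).integrableOn (hZi s).integrableOn, hswap] at hd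
  linarith

end

/-! ### Polynomials of degree at most one and two -/

/-- A polynomial of degree at most one is an affine function. -/
theorem MvPolynomial.eval_eq_of_totalDegree_le_one {n : ℕ} {q : MvPolynomial (Fin n) ℝ}
    (hq : q.totalDegree ≤ 1) (x : Fin n → ℝ) :
    eval x q = ∑ j, q.coeff (Finsupp.single j 1) * x j + q.coeff 0 := by
  classical
  have hq' : q = ∑ j, C (q.coeff (Finsupp.single j 1)) * X j + C (q.coeff 0) := by
    ext m
    simp only [coeff_add, coeff_sum, coeff_C_mul, coeff_X, coeff_C]
    by_cases hm0 : m = 0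
    · subst hm0
      simp
    by_cases hm1 : ∃ i, m = Finsupp.single i 1
    · obtain ⟨i, rfl⟩ := hm1
      rw [if_neg (fun h => hm0 h.symm)]
      simp [Finsupp.single_left_inj, eq_comm]
    · have hdeg : 1 < m.degree := by
        by_contra hcon
        have h1 : m.degree = 0 ∨ m.degree = 1 := by omega
        rcases h1 with h1 | h1
        · exact hm0 ((Finsupp.degree_eq_zero_iff m).1 h1)
        · have h2 : m ∈ Set.range fun i : Fin n => Finsupp.single i 1 := by
            rw [Finsupp.range_single_one]
            exact h1
          exact hm1 (h2.imp fun _ h => h.symm)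
      rw [coeff_eq_zero_of_totalDegree_lt (by
        have : m.degree = ∑ i ∈ m.support, m i := rfl
        omega), if_neg (fun h => hm0 h.symm), Finset.sum_eq_zero, add_zero]
      intro i _
      rw [if_neg (fun h => hm1 ⟨i, h.symm⟩), mul_zero]
  conv_lhs => rw [hq']
  simp

/-- A polynomial of degree at most two grows at most quadratically. -/
theorem MvPolynomial.exists_abs_eval_le_of_totalDegree_le_two {n : ℕ} {q : MvPolynomial (Fin n) ℝ}
    (hq : q.totalDegree ≤ 2) :
    ∃ C : ℝ, 0 ≤ C ∧ ∀ x, |eval x q| ≤ C * (1 + ∑ i, x i ^ 2) := by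
  -- With S = 1 + ∑ xᵢ² ≥ 1 and |xᵢ| ≤ √S, each monomial of degree at most two is at most S. The
  -- factor 2 is slack.
  refine ⟨∑ d ∈ q.support, |q.coeff d| * 2, by positivity, fun x => ?_⟩
  set S : ℝ := 1 + ∑ i, x i ^ 2 with hS
  have hS1 : 1 ≤ S := le_add_of_nonneg_right (Finset.sum_nonneg fun i _ => sq_nonneg _)
  have hx : ∀ i, |x i| ≤ √S := fun i => by
    refine Real.abs_le_sqrt ?_
    have := Finset.single_le_sum (f := fun i => x i ^ 2) (fun i _ => sq_nonneg _) (Finset.mem_univ i)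
    linarith
  have hs1 : 1 ≤ √S := Real.one_le_sqrt.2 hS1
  rw [eval_eq, Finset.sum_mul]
  refine (Finset.abs_sum_le_sum_abs _ _).trans (Finset.sum_le_sum fun d hd => ?_)
  have hd2 : ∑ i ∈ d.support, d i ≤ 2 := (le_totalDegree hd).trans hq
  rw [abs_mul, Finset.abs_prod, mul_assoc]
  refine mul_le_mul_of_nonneg_left ?_ (abs_nonneg _)
  calc ∏ i ∈ d.support, |x i ^ d i| ≤ ∏ i ∈ d.support, √S ^ d i := by
        refine Finset.prod_le_prod (fun i _ => abs_nonneg _) fun i _ => ?_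
        rw [abs_pow]
        exact pow_le_pow_left₀ (abs_nonneg _) (hx i) _
    _ = √S ^ (∑ i ∈ d.support, d i) := by rw [Finset.prod_pow_eq_pow_sum]
    _ ≤ √S ^ 2 := pow_le_pow_right₀ hs1 hd2
    _ = S := Real.sq_sqrt (by linarith)
    _ ≤ 2 * S := by linarith

/-! ### Matrix exponential and linear differential equations -/

section

attribute [local instance] Matrix.linftyOpNormedRing Matrix.linftyOpNormedAlgebra

/-- The matrix norm is installed locally, only to differentiate the exponential; passing to entries
by a continuous linear functional frees the result from that choice. -/
theorem Matrix.hasDerivAt_exp_smul_apply {n : ℕ} (G : Matrix (Fin n) (Fin n) ℝ) (T v : ℝ)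
    (i j : Fin n) :
    HasDerivAt (fun v : ℝ => NormedSpace.exp ((T - v) • G) i j)
      (-((NormedSpace.exp ((T - v) • G) * G) i j)) v := by
  have h1 : HasDerivAt (fun r : ℝ => NormedSpace.exp (r • G))
      (NormedSpace.exp ((T - v) • G) * G) (T - v) := hasDerivAt_exp_smul_const (𝕂 := ℝ) G (T - v)
  have h2 : HasDerivAt (fun v : ℝ => T - v) (-1) v := by
    simpa using (hasDerivAt_id v).const_sub T
  have h3 := HasDerivAt.scomp v h1 h2
  let L : Matrix (Fin n) (Fin n) ℝ →L[ℝ] ℝ :=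
    LinearMap.toContinuousLinearMap (Matrix.entryLinearMap ℝ ℝ i j)
  have h4 := L.hasFDerivAt.comp_hasDerivAt v h3
  refine h4.congr_deriv ?_
  change L ((-1 : ℝ) • _) = _
  rw [neg_one_smul, map_neg]
  rfl

theorem Matrix.continuous_exp_smul_apply {n : ℕ} (G : Matrix (Fin n) (Fin n) ℝ)
    (i j : Fin n) : Continuous (fun r : ℝ => NormedSpace.exp (r • G) i j) := by
  have : (fun r : ℝ => NormedSpace.exp (r • G) i j) =
      (fun v : ℝ => NormedSpace.exp ((0 - v) • G) i j) ∘ fun r => -r := by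
    funext r; simp
  rw [this]
  exact (continuous_iff_continuousAt.2 fun v =>
    (Matrix.hasDerivAt_exp_smul_apply G 0 v i j).continuousAt).comp continuous_neg

end

theorem Matrix.continuous_exp_smul_mulVec {n : ℕ} (G : Matrix (Fin n) (Fin n) ℝ) (c : Fin n → ℝ) :
    Continuous (fun r : ℝ => NormedSpace.exp (r • G) *ᵥ c) := by
  refine continuous_pi fun i => ?_
  simp only [Matrix.mulVec, dotProduct]
  exact continuous_finsetSum _ fun j _ => (Matrix.continuous_exp_smul_apply G i j).mul_const _

/-- Variation of constants for the integral form of `u' = G u + c`. -/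
theorem eq_exp_mulVec_add_integral {n : ℕ} (G : Matrix (Fin n) (Fin n) ℝ) (c : Fin n → ℝ)
    {u : ℝ → Fin n → ℝ} {t T : ℝ} (htT : t ≤ T)
    (hi : ∀ i, IntervalIntegrable (fun v => u v i) volume t T)
    (hu : ∀ v ∈ Set.Icc t T, ∀ i, u v i = u t i + ∫ s in t..v, (G *ᵥ u s + c) i) (i : Fin n) :
    u T i = (NormedSpace.exp ((T - t) • G) *ᵥ u t) i
      + ∫ v in t..T, (NormedSpace.exp ((T - v) • G) *ᵥ c) i := by
  have hF : ∀ i, IntervalIntegrable (fun s => (G *ᵥ u s + c) i) volume t T := fun i => by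
    simp only [Pi.add_apply, Matrix.mulVec, dotProduct]
    refine IntervalIntegrable.add ?_ intervalIntegrable_const
    have := IntervalIntegrable.sum (μ := volume) (a := t) (b := T) Finset.univ
      (f := fun j s => G i j * u s j) fun j _ => (hi j).const_mul _
    simpa only [Finset.sum_fn] using this
  -- Bootstrap: u is only known to be integrable, but the integral equation makes it continuous, and
  -- then differentiable in the interior.
  have huc : ∀ i, ContinuousOn (fun v => u v i) (Set.Icc t T) := fun i => by
    have h1 : ContinuousOn (fun v => u t i + ∫ s in t..v, (G *ᵥ u s + c) i) (Set.Icc t T) := by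
      refine continuousOn_const.add ?_
      have := intervalIntegral.continuousOn_primitive_interval' (hF i) (Set.left_mem_uIcc)
      rwa [Set.uIcc_of_le htT] at this
    exact h1.congr fun v hv => hu v hv i
  have hFc : ∀ i, ContinuousOn (fun s => (G *ᵥ u s + c) i) (Set.Icc t T) := fun i => by
    simp only [Pi.add_apply, Matrix.mulVec, dotProduct]
    exact (continuousOn_finsetSum _ fun j _ => continuousOn_const.mul (huc j)).add
      continuousOn_const
  have hd : ∀ v ∈ Set.Ioo t T, ∀ i, HasDerivAt (fun v => u v i) ((G *ᵥ u v + c) i) v := by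
    intro v hv i
    have hn : Set.Icc t T ∈ 𝓝 v := Icc_mem_nhds hv.1 hv.2
    have h1 : HasDerivAt (fun v => u t i + ∫ s in t..v, (G *ᵥ u s + c) i) ((G *ᵥ u v + c) i) v := by
      refine HasDerivAt.const_add _ ?_
      refine intervalIntegral.integral_hasDerivAt_right ?_ ?_ ((hFc i).continuousAt hn)
      · exact (hF i).mono_set (by
          rw [Set.uIcc_of_le hv.1.le, Set.uIcc_of_le htT]
          exact Set.Icc_subset_Icc_right hv.2.le)
      · exact ⟨Set.Icc t T, hn, (hFc i).aestronglyMeasurable measurableSet_Icc⟩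
    exact h1.congr_of_eventuallyEq (Filter.eventually_of_mem hn fun v hv => hu v hv i)
  set E : ℝ → Matrix (Fin n) (Fin n) ℝ := fun v => NormedSpace.exp ((T - v) • G) with hE
  have hEc : ∀ i j, Continuous fun v => E v i j := fun i j =>
    (Matrix.continuous_exp_smul_apply G i j).comp (continuous_const.sub continuous_id)
  have hftc := intervalIntegral.integral_eq_sub_of_hasDeriv_right_of_le htT
    (f := fun v => (E v *ᵥ u v) i) (f' := fun v => (E v *ᵥ c) i) ?_ ?_ ?_
  · rw [hftc]
    have hET : E T = 1 := by simp [hE]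
    rw [hET, Matrix.one_mulVec]
    ring
  · simp only [Matrix.mulVec, dotProduct]
    exact continuousOn_finsetSum _ fun j _ => (hEc i j).continuousOn.mul (huc j)
  · intro v hv
    refine HasDerivAt.hasDerivWithinAt ?_
    have h1 : HasDerivAt (fun v => ∑ j, E v i j * u v j)
        (∑ j, (-((E v * G) i j) * u v j + E v i j * (G *ᵥ u v + c) j)) v :=
      HasDerivAt.fun_sum fun j _ => (Matrix.hasDerivAt_exp_smul_apply G T v i j).mul (hd v hv j)
    refine h1.congr_deriv ?_
    -- The terms E G u cancel, so the derivative of E(v)u(v) is E(v)c.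
    have h2 : (E v *ᵥ c) i = -((E v * G) *ᵥ u v) i + (E v *ᵥ (G *ᵥ u v + c)) i := by
      rw [Matrix.mulVec_add, Matrix.mulVec_mulVec, Pi.add_apply]
      ring
    rw [h2, Finset.sum_add_distrib]
    simp only [Matrix.mulVec, dotProduct, neg_mul, Finset.sum_neg_distrib]
  · refine Continuous.intervalIntegrable ?_ _ _
    simp only [Matrix.mulVec, dotProduct]
    exact continuous_finsetSum _ fun j _ => (hEc i j).mul_const _

/-! ### Moments of polynomial processes -/

/-- With `one_add_sum_sq_le`, the passage between the maximum norm, used for integrability, and the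
polynomial to which the generator is applied. -/
theorem norm_sq_le_one_add_sum_sq {n : ℕ} (x : Fin n → ℝ) : ‖x‖ ^ 2 ≤ 1 + ∑ i, x i ^ 2 := by
  have h0 : 0 ≤ 1 + ∑ i, x i ^ 2 := by positivity
  have h : ‖x‖ ≤ √(1 + ∑ i, x i ^ 2) := by
    refine (pi_norm_le_iff_of_nonneg (Real.sqrt_nonneg _)).2 fun i => Real.abs_le_sqrt ?_
    have := Finset.single_le_sum (f := fun i => x i ^ 2) (fun i _ => sq_nonneg _) (Finset.mem_univ i)
    linarith
  calc ‖x‖ ^ 2 ≤ √(1 + ∑ i, x i ^ 2) ^ 2 := pow_le_pow_left₀ (norm_nonneg _) h 2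
    _ = _ := Real.sq_sqrt h0

theorem one_add_sum_sq_le {n : ℕ} (x : Fin n → ℝ) : 1 + ∑ i, x i ^ 2 ≤ 1 + n * ‖x‖ ^ 2 := by
  have : ∑ i, x i ^ 2 ≤ ∑ _i : Fin n, ‖x‖ ^ 2 := Finset.sum_le_sum fun i _ => by
    rw [← sq_abs]
    exact pow_le_pow_left₀ (abs_nonneg _) (norm_le_pi_norm x i) 2
  simpa using this

section

variable {Ω : Type*} {mΩ : MeasurableSpace Ω} {n : ℕ} {𝓕 : Filtration ℝ≥0 mΩ} {Q : Measure Ω}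
  {X : ℝ≥0 → Ω → (Fin n → ℝ)}

theorem IsPolynomialProcess.adapted_comp (hX : IsPolynomialProcess 𝓕 Q X) {φ : (Fin n → ℝ) → ℝ}
    (hφ : Continuous φ) : StronglyAdapted 𝓕 fun t ω => φ (X t ω) :=
  fun t => hφ.comp_stronglyMeasurable (hX.adapted t)

theorem IsPolynomialProcess.cadlag_comp (hX : IsPolynomialProcess 𝓕 Q X) {φ : (Fin n → ℝ) → ℝ}
    (hφ : Continuous φ) (ω : Ω) : IsCadlagPath fun t => φ (X t ω) :=
  (hX.cadlag ω).comp_continuous hφ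

/-- Weighted second moments of a polynomial process at capped stopping times. -/
theorem IsPolynomialProcess.exists_second_moment_bound [IsFiniteMeasure Q]
    (hX : IsPolynomialProcess 𝓕 Q X) :
    ∃ C : ℝ, 0 ≤ C ∧ ∀ w : Ω → ℝ, StronglyMeasurable[𝓕 0] w → (∀ ω, 0 ≤ w ω) → (∀ ω, w ω ≤ 1) →
      ∀ τ, IsStoppingTime 𝓕 τ → ∀ t : ℝ≥0,
      ∫⁻ ω, ENNReal.ofReal (w ω * (1 + ∑ i, X (cappedTime t (τ ω)) ω i ^ 2)) ∂Q
        ≤ ENNReal.ofReal (Real.exp (C * t))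
          * ∫⁻ ω, ENNReal.ofReal (w ω * (1 + ∑ i, X 0 ω i ^ 2)) ∂Q := by
  -- The constant 1 lets p dominate the lower-order terms of its image under the generator.
  set p : MvPolynomial (Fin n) ℝ := 1 + ∑ i, MvPolynomial.X i ^ 2 with hp
  have hpe : ∀ x, MvPolynomial.eval x p = 1 + ∑ i, x i ^ 2 := fun x => by simp [hp]
  have hpd : p.totalDegree ≤ 2 := by
    refine (MvPolynomial.totalDegree_add _ _).trans (max_le (by simp) ?_)
    exact MvPolynomial.totalDegree_finsetSum_le fun i _ => by simp
  obtain ⟨q, hq, hgen⟩ := hX.generator_polynomial 2 p hpd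
  obtain ⟨C, hC, hqC⟩ := MvPolynomial.exists_abs_eval_le_of_totalDegree_le_two hq
  have hpc : Continuous fun x : Fin n → ℝ => MvPolynomial.eval x p := p.continuous_eval
  have hqc : Continuous fun x : Fin n → ℝ => MvPolynomial.eval x q := q.continuous_eval
  refine ⟨C, hC, fun w hw hw0 hw1 τ hτ t => ?_⟩
  have h := lintegral_weight_mul_stopped_le (hX.adapted_comp hpc) (hX.cadlag_comp hpc)
    (hX.adapted_comp hqc) (hX.cadlag_comp hqc) hC
    (fun t ω => by rw [hpe]; positivity)
    (fun t ω => by rw [hpe]; exact (le_abs_self _).trans (hqC _)) hgen.2.2.2 hw hw0 hw1 hτ t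
  simpa only [hpe] using h

/-- First moments of a polynomial process with integrable initial value are bounded on compact
time intervals. -/
theorem IsPolynomialProcess.exists_first_moment_bound [IsFiniteMeasure Q]
    (hX : IsPolynomialProcess 𝓕 Q X) (hX0 : Integrable (X 0) Q) (t : ℝ≥0) :
    ∃ L : ℝ, ∀ u ≤ t, Integrable (X u) Q ∧ ∫ ω, ‖X u ω‖ ∂Q ≤ L := by
  obtain ⟨C, hC, hmom⟩ := hX.exists_second_moment_bound
  -- This weight turns the quadratic growth of the initial second moment into linear growth in
  -- ‖X(0)‖, which is integrable.
  set w : Ω → ℝ := fun ω => (1 + ‖X 0 ω‖)⁻¹ with hw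
  have hpos : ∀ ω, 0 < 1 + ‖X 0 ω‖ := fun ω => by positivity
  have hwm : StronglyMeasurable[𝓕 0] w :=
    (stronglyMeasurable_const.add (hX.adapted 0).norm).inv₀
  have hw0 : ∀ ω, 0 ≤ w ω := fun ω => (inv_pos.2 (hpos ω)).le
  have hw1 : ∀ ω, w ω ≤ 1 := fun ω => inv_le_one_of_one_le₀ (by simp)
  have hi0 : Integrable (fun ω => (1 + n) * (1 + ‖X 0 ω‖)) Q :=
    ((integrable_const 1).add hX0.norm).const_mul _
  set K : ℝ := ∫ ω, (1 + n) * (1 + ‖X 0 ω‖) ∂Q with hK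
  have hK0 : 0 ≤ K := integral_nonneg fun ω => by positivity
  have hinit : ∫⁻ ω, ENNReal.ofReal (w ω * (1 + ∑ i, X 0 ω i ^ 2)) ∂Q ≤ ENNReal.ofReal K := by
    rw [hK, ofReal_integral_eq_lintegral_ofReal hi0 (ae_of_all _ fun ω => by positivity)]
    refine lintegral_mono fun ω => ENNReal.ofReal_le_ofReal ?_
    have h1 := one_add_sum_sq_le (X 0 ω)
    rw [hw, inv_mul_le_iff₀ (hpos ω)]
    refine h1.trans ?_
    have h2 := norm_nonneg (X 0 ω)
    have h3 : (0 : ℝ) ≤ n := Nat.cast_nonneg n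
    nlinarith [mul_nonneg h3 h2, sq_nonneg ‖X 0 ω‖]
  refine ⟨Real.exp (C * t) * K + ∫ ω, (1 + ‖X 0 ω‖) ∂Q, fun u hu => ?_⟩
  set V : Ω → ℝ := fun ω => w ω * (1 + ∑ i, X u ω i ^ 2) with hV
  have hVm : Measurable V := by
    refine (hwm.mono (𝓕.le 0)).measurable.mul ?_
    have hc : Continuous fun x : Fin n → ℝ => 1 + ∑ i, x i ^ 2 := by fun_prop
    exact ((hX.adapted_comp hc u).mono (𝓕.le u)).measurable
  have hV0 : ∀ ω, 0 ≤ V ω := fun ω => mul_nonneg (hw0 ω) (by positivity)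
  have hVb : ∫⁻ ω, ENNReal.ofReal (V ω) ∂Q ≤ ENNReal.ofReal (Real.exp (C * t) * K) := by
    -- The stopping time ⊤ gives the bound at the deterministic time u.
    have h := hmom w hwm hw0 hw1 (fun _ => ⊤) (fun i => by simp) u
    simp only [cappedTime_top] at h
    refine h.trans ?_
    rw [ENNReal.ofReal_mul (Real.exp_pos _).le]
    gcongr
  have hVi : Integrable V Q := (lintegral_ofReal_ne_top_iff_integrable
    hVm.aestronglyMeasurable (ae_of_all _ hV0)).1 (hVb.trans_lt ENNReal.ofReal_lt_top).ne
  have hVint : ∫ ω, V ω ∂Q ≤ Real.exp (C * t) * K := by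
    rw [← ofReal_integral_eq_lintegral_ofReal hVi (ae_of_all _ hV0)] at hVb
    exact (ENNReal.ofReal_le_ofReal_iff (by positivity)).1 hVb
  have hi1 : Integrable (fun ω => 1 + ‖X 0 ω‖) Q := (integrable_const 1).add hX0.norm
  have hle : ∀ ω, ‖X u ω‖ ≤ V ω + (1 + ‖X 0 ω‖) := fun ω => by
    have h1 := norm_sq_le_one_add_sum_sq (X u ω)
    have h2 : w ω * ‖X u ω‖ ^ 2 ≤ V ω := mul_le_mul_of_nonneg_left h1 (hw0 ω)
    have h3 : w ω * (1 + ‖X 0 ω‖) = 1 := inv_mul_cancel₀ (hpos ω).ne'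
    -- Expanding this square, with w(1+‖X(0)‖) = 1, gives 2‖X_u‖ ≤ w‖X_u‖² + 1 + ‖X(0)‖.
    have h4 : 0 ≤ w ω * (‖X u ω‖ - (1 + ‖X 0 ω‖)) ^ 2 := mul_nonneg (hw0 ω) (sq_nonneg _)
    have h5 : w ω * (‖X u ω‖ - (1 + ‖X 0 ω‖)) ^ 2
        = w ω * ‖X u ω‖ ^ 2 - 2 * ‖X u ω‖ * (w ω * (1 + ‖X 0 ω‖))
          + (w ω * (1 + ‖X 0 ω‖)) * (1 + ‖X 0 ω‖) := by ring
    rw [h5, h3] at h4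
    linarith [norm_nonneg (X u ω), hV0 ω, hpos ω]
  have hXi : Integrable (X u) Q :=
    (hVi.add hi1).mono' ((hX.adapted u).mono (𝓕.le u)).aestronglyMeasurable (ae_of_all _ hle)
  refine ⟨hXi, ?_⟩
  calc ∫ ω, ‖X u ω‖ ∂Q ≤ ∫ ω, (V ω + (1 + ‖X 0 ω‖)) ∂Q :=
        integral_mono hXi.norm (hVi.add hi1) hle
    _ = ∫ ω, V ω ∂Q + ∫ ω, (1 + ‖X 0 ω‖) ∂Q := integral_add hVi hi1
    _ ≤ _ := by gcongr

/-- The generator maps coordinates to affine functions. -/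
theorem IsPolynomialProcess.exists_generatorOnCoordinates (hX : IsPolynomialProcess 𝓕 Q X) :
    ∃ (G : Matrix (Fin n) (Fin n) ℝ) (b : Fin n → ℝ), GeneratorOnCoordinates 𝓕 Q X G b := by
  choose q hq hgen using fun i : Fin n => hX.generator_polynomial 1 (MvPolynomial.X i) (by simp)
  refine ⟨Matrix.of fun i j => (q i).coeff (Finsupp.single j 1), fun i => (q i).coeff 0,
    fun i => ?_⟩
  have h := hgen i
  simp only [MvPolynomial.eval_X] at h
  convert h using 2 with x
  rw [MvPolynomial.eval_eq_of_totalDegree_le_one (hq i)]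
  simp [Matrix.mulVec, dotProduct]

/-- The integrated Dynkin formula for the coordinates of a polynomial process. -/
theorem IsPolynomialProcess.setIntegral_coordinate_eq [IsFiniteMeasure Q]
    (hX : IsPolynomialProcess 𝓕 Q X) (hX0 : Integrable (X 0) Q)
    {G : Matrix (Fin n) (Fin n) ℝ} {b : Fin n → ℝ} (hG : GeneratorOnCoordinates 𝓕 Q X G b)
    {s t : ℝ≥0} (hst : s ≤ t) {B : Set Ω} (hB : MeasurableSet[𝓕 s] B) (i : Fin n) :
    ∫ ω in B, X t ω i ∂Q = ∫ ω in B, X s ω i ∂Q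
      + ∫ v in (s : ℝ)..t, ∫ ω in B, (G *ᵥ X v.toNNReal ω + b) i ∂Q := by
  have hXi : ∀ u, Integrable (X u) Q := fun u =>
    ((hX.exists_first_moment_bound hX0 u).choose_spec u le_rfl).1
  have hc : Continuous fun x : Fin n → ℝ => x i := continuous_apply i
  have hd : Continuous fun x : Fin n → ℝ => (G *ᵥ x + b) i := by
    simp only [Pi.add_apply, Matrix.mulVec, dotProduct]
    fun_prop
  have hbd : ∀ x : Fin n → ℝ, ‖(G *ᵥ x + b) i‖ ≤ (∑ j, ‖G i j‖) * ‖x‖ + ‖b i‖ := fun x => by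
    have h1 : ‖(G *ᵥ x) i‖ ≤ (∑ j, ‖G i j‖) * ‖x‖ := by
      rw [Finset.sum_mul]
      refine (norm_sum_le Finset.univ fun j => G i j * x j).trans (Finset.sum_le_sum fun j _ => ?_)
      rw [norm_mul]
      exact mul_le_mul_of_nonneg_left (norm_le_pi_norm x j) (norm_nonneg _)
    exact (norm_add_le _ _).trans (by gcongr)
  have hbi : ∀ u, Integrable (fun ω => (∑ j, ‖G i j‖) * ‖X u ω‖ + ‖b i‖) Q := fun u =>
    ((hXi u).norm.const_mul _).add (integrable_const _)
  have hhi : ∀ u, Integrable (fun ω => (G *ᵥ X u ω + b) i) Q := fun u =>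
    (hbi u).mono' ((hX.adapted_comp hd u).mono (𝓕.le u)).aestronglyMeasurable
      (ae_of_all _ fun ω => hbd _)
  have hnm : Measurable[𝓕 0] fun ω => ‖X 0 ω‖ := (hX.adapted 0).norm.measurable
  have hAm : ∀ m : ℕ, MeasurableSet[𝓕 0] {ω | ‖X 0 ω‖ ≤ m} := fun m => hnm measurableSet_Iic
  refine setIntegral_eq_add_integral_drift (hX.adapted_comp hc) (hX.cadlag_comp hc)
    (hX.adapted_comp hd) (hX.cadlag_comp hd) (fun u => (hXi u).eval i) hhi (fun u => ?_)
    (hG i).2.2.2 (A := fun m : ℕ => {ω | ‖X 0 ω‖ ≤ m}) hAm ?_ ?_ (fun m u => ?_) hst hB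
  · obtain ⟨L, hL⟩ := hX.exists_first_moment_bound hX0 u
    refine ⟨(∑ j, ‖G i j‖) * L + ∫ _ω, ‖b i‖ ∂Q, fun v hv => ?_⟩
    refine (integral_mono (hhi v).norm (hbi v) fun ω => hbd _).trans ?_
    rw [integral_add ((hXi v).norm.const_mul _) (integrable_const _), integral_const_mul]
    gcongr
    exact (hL v hv).2
  · exact fun k l hkl ω hω => le_trans (Set.mem_ofPred_eq ▸ hω) (Nat.cast_le.2 hkl)
  · refine Set.eq_univ_of_forall fun ω => Set.mem_iUnion.2 ?_
    exact exists_nat_ge ‖X 0 ω‖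
  · obtain ⟨C, hC, hmom⟩ := hX.exists_second_moment_bound
    set A : Set Ω := {ω | ‖X 0 ω‖ ≤ m} with hA
    -- On A the initial second moment is at most 1 + n m², which makes the weighted bound finite and
    -- independent of τ.
    set w : Ω → ℝ := A.indicator fun _ => 1 with hw
    have hwm : StronglyMeasurable[𝓕 0] w := stronglyMeasurable_const.indicator (hAm m)
    have hw0 : ∀ ω, 0 ≤ w ω := fun ω => Set.indicator_nonneg (fun _ _ => zero_le_one) ω
    have hw1 : ∀ ω, w ω ≤ 1 := fun ω => Set.indicator_le_self' (fun _ _ => zero_le_one) ω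
    refine ⟨ENNReal.ofReal (Real.exp (C * u)) * ∫⁻ _ω, ENNReal.ofReal (1 + n * (m : ℝ) ^ 2) ∂Q,
      ENNReal.mul_ne_top ENNReal.ofReal_ne_top ?_, fun τ hτ => ?_⟩
    · rw [lintegral_const]
      exact ENNReal.mul_ne_top ENNReal.ofReal_ne_top (measure_ne_top _ _)
    · calc ∫⁻ ω in A, ENNReal.ofReal (X (cappedTime u (τ ω)) ω i ^ 2) ∂Q
          ≤ ∫⁻ ω, ENNReal.ofReal (w ω * (1 + ∑ i, X (cappedTime u (τ ω)) ω i ^ 2)) ∂Q := by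
            rw [← lintegral_indicator (𝓕.le 0 _ (hAm m))]
            refine lintegral_mono fun ω => ?_
            by_cases h : ω ∈ A
            · rw [Set.indicator_of_mem h, hw, Set.indicator_of_mem h, one_mul]
              refine ENNReal.ofReal_le_ofReal ?_
              have := Finset.single_le_sum (f := fun i => X (cappedTime u (τ ω)) ω i ^ 2)
                (fun i _ => sq_nonneg _) (Finset.mem_univ i)
              linarith
            · rw [Set.indicator_of_notMem h]
              exact zero_le
        _ ≤ _ := hmom w hwm hw0 hw1 τ hτ u
        _ ≤ _ := by
            gcongr with ω
            by_cases h : ω ∈ A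
            · rw [hw, Set.indicator_of_mem h, one_mul]
              refine (one_add_sum_sq_le _).trans ?_
              gcongr
              exact h
            · rw [hw, Set.indicator_of_notMem h, zero_mul]
              positivity

/-- The conditional expectation of a polynomial process, integrated over an event. -/
theorem IsPolynomialProcess.setIntegral_coordinate_eq_exp [IsFiniteMeasure Q]
    (hX : IsPolynomialProcess 𝓕 Q X) (hX0 : Integrable (X 0) Q)
    {G : Matrix (Fin n) (Fin n) ℝ} {b : Fin n → ℝ} (hG : GeneratorOnCoordinates 𝓕 Q X G b)
    {t T : ℝ≥0} (htT : t ≤ T) {B : Set Ω} (hB : MeasurableSet[𝓕 t] B) (i : Fin n) :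
    ∫ ω in B, X T ω i ∂Q
      = (NormedSpace.exp (((T : ℝ) - t) • G) *ᵥ fun j => ∫ ω in B, X t ω j ∂Q) i
        + Q.real B * ∫ v in (t : ℝ)..T, (NormedSpace.exp (((T : ℝ) - v) • G) *ᵥ b) i := by
  obtain ⟨L, hL⟩ := hX.exists_first_moment_bound hX0 T
  have hXi : ∀ u, Integrable (X u) Q := fun u =>
    ((hX.exists_first_moment_bound hX0 u).choose_spec u le_rfl).1
  have htT' : (t : ℝ) ≤ T := by exact_mod_cast htT
  set u : ℝ → Fin n → ℝ := fun v j => ∫ ω in B, X v.toNNReal ω j ∂Q with hu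
  have hi : ∀ j, IntervalIntegrable (fun v => u v j) volume t T := fun j => by
    have hc : Continuous fun x : Fin n → ℝ => x j := continuous_apply j
    refine intervalIntegrable_integral_of_moment_bound (Q := Q.restrict B) (K := L)
      (Z := fun s ω => X s ω j)
      (measurable_uncurry_of_adapted_cadlag (hX.adapted_comp hc) (hX.cadlag_comp hc))
      (fun v _ => ((hXi v).eval j).integrableOn) (fun v hv => ?_) T.2 htT'
    refine (setIntegral_le_integral ((hXi v).eval j).norm
      (ae_of_all _ fun _ => norm_nonneg _)).trans (le_trans ?_ (hL v (by exact_mod_cast hv)).2)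
    exact integral_mono ((hXi v).eval j).norm (hXi v).norm fun ω => norm_le_pi_norm (X v ω) j
  -- Integrating the affine drift over B closes the system in u, with Q(B)b as the constant term.
  have hdrift : ∀ v : ℝ, ∀ j, ∫ ω in B, (G *ᵥ X v.toNNReal ω + b) j ∂Q
      = (G *ᵥ u v + Q.real B • b) j := fun v j => by
    simp only [Pi.add_apply, Matrix.mulVec, dotProduct, Pi.smul_apply, smul_eq_mul, hu]
    rw [integral_add (integrable_finsetSum _ fun k _ =>
        (((hXi v.toNNReal).eval k).const_mul (G j k)).integrableOn) (integrable_const _),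
      integral_finsetSum _ fun k _ =>
        (((hXi v.toNNReal).eval k).const_mul (G j k)).integrableOn]
    simp [integral_const_mul]
  have h := eq_exp_mulVec_add_integral G (Q.real B • b) (u := u) htT' hi (fun v hv j => by
    have h1 := hX.setIntegral_coordinate_eq hX0 hG
      (NNReal.le_toNNReal_of_coe_le hv.1) hB j
    simp only [Real.coe_toNNReal v (t.2.trans hv.1), hdrift] at h1
    simpa [hu] using h1) i
  simp only [hu, Real.toNNReal_coe] at h
  rw [h]
  congr 1
  rw [← intervalIntegral.integral_const_mul]
  refine intervalIntegral.integral_congr fun v _ => ?_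
  simp only [Matrix.mulVec_smul, Pi.smul_apply, smul_eq_mul]

/-! ### The affine property -/

theorem integral_exp_mulVec_apply (G : Matrix (Fin n) (Fin n) ℝ) (b : Fin n → ℝ) (t T : ℝ)
    (i : Fin n) :
    (∫ v in t..T, NormedSpace.exp ((T - v) • G) *ᵥ b) i
      = ∫ v in t..T, (NormedSpace.exp ((T - v) • G) *ᵥ b) i := by
  have hc : Continuous fun v : ℝ => NormedSpace.exp ((T - v) • G) *ᵥ b :=
    (Matrix.continuous_exp_smul_mulVec G b).comp (continuous_const.sub continuous_id)
  exact ((ContinuousLinearMap.proj (R := ℝ) (φ := fun _ : Fin n => ℝ) i).intervalIntegral_comp_comm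
    (hc.intervalIntegrable t T)).symm

/-- The substitution v ↦ T - v exhibits dependence on T - t alone, which yields homogeneity and also
joint measurability, by continuity in T - t. -/
theorem integral_exp_mulVec_eq (G : Matrix (Fin n) (Fin n) ℝ) (b : Fin n → ℝ) (t T : ℝ) :
    ∫ v in t..T, NormedSpace.exp ((T - v) • G) *ᵥ b
      = ∫ v in (0 : ℝ)..(T - t), NormedSpace.exp (v • G) *ᵥ b := by
  have := intervalIntegral.integral_comp_sub_left (a := t) (b := T)
    (fun v : ℝ => NormedSpace.exp (v • G) *ᵥ b) T
  simpa using this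

/-- A polynomial process with integrable initial value is affine, with the matrix exponential
formula. -/
theorem IsPolynomialProcess.isAffineWith [IsFiniteMeasure Q]
    (hX : IsPolynomialProcess 𝓕 Q X) (hX0 : Integrable (X 0) Q)
    {G : Matrix (Fin n) (Fin n) ℝ} {b : Fin n → ℝ} (hG : GeneratorOnCoordinates 𝓕 Q X G b) :
    IsAffineWith 𝓕 Q X (fun t T => NormedSpace.exp (((T : ℝ) - t) • G))
      (fun t T => ∫ s in (t : ℝ)..T, NormedSpace.exp (((T : ℝ) - s) • G) *ᵥ b) := by
  have hXi : IsIntegrableProcess Q X := fun u =>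
    ((hX.exists_first_moment_bound hX0 u).choose_spec u le_rfl).1
  have hsub : Continuous fun r : ℝ≥0 × ℝ≥0 => (r.2 : ℝ) - r.1 := by fun_prop
  refine ⟨fun i j => ?_, ?_, hXi, fun t T htT => ?_⟩
  · exact ((Matrix.continuous_exp_smul_apply G i j).comp hsub).measurable
  · simp only [integral_exp_mulVec_eq]
    exact ((intervalIntegral.continuous_primitive (fun a c =>
      (Matrix.continuous_exp_smul_mulVec G b).intervalIntegrable a c) 0).comp hsub).measurable
  · set E : Matrix (Fin n) (Fin n) ℝ := NormedSpace.exp (((T : ℝ) - t) • G) with hE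
    set a : Fin n → ℝ := ∫ s in (t : ℝ)..T, NormedSpace.exp (((T : ℝ) - s) • G) *ᵥ b with ha
    have hφ : Continuous fun x : Fin n → ℝ => E *ᵥ x + a := by fun_prop
    have hEi : ∀ i, Integrable (fun ω => (E *ᵥ X t ω) i) Q := fun i => by
      simp only [Matrix.mulVec, dotProduct]
      exact integrable_finsetSum _ fun j _ => ((hXi t).eval j).const_mul _
    have hint : ∀ i, Integrable (fun ω => (E *ᵥ X t ω + a) i) Q := fun i =>
      (hEi i).add (integrable_const _)
    refine (ae_eq_condExp_of_forall_setIntegral_eq (𝓕.le t) (hXi T)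
      (fun B _ _ => (Integrable.of_eval hint).integrableOn) (fun B hB _ => ?_)
      (hφ.comp_stronglyMeasurable (hX.adapted t)).aestronglyMeasurable).symm
    funext i
    rw [eval_integral (fun i => (hint i).integrableOn),
      eval_integral (fun i => ((hXi T).eval i).integrableOn),
      hX.setIntegral_coordinate_eq_exp hX0 hG htT hB i, ← integral_exp_mulVec_apply]
    simp only [Pi.add_apply]
    rw [integral_add (hEi i).integrableOn (integrable_const _)]
    simp only [Matrix.mulVec, dotProduct]
    rw [integral_finsetSum _ fun j _ => (((hXi t).eval j).const_mul (E i j)).integrableOn]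
    simp [integral_const_mul, ha, hE]

end

theorem proposition3p2 {Ω : Type*} {mΩ : MeasurableSpace Ω} {n : ℕ}
    (Q : Measure Ω) [IsProbabilityMeasure Q]
    (𝓕 : Filtration ℝ≥0 mΩ) (h𝓕 : UsualConditions 𝓕 Q)
    (X : ℝ≥0 → Ω → (Fin n → ℝ))
    (hX : IsPolynomialProcess 𝓕 Q X) (hX0 : Integrable (X 0) Q) :
    IsIntegrableProcess Q X ∧
    IsAffineProcess 𝓕 Q X ∧
    (∃ (G : Matrix (Fin n) (Fin n) ℝ) (b : Fin n → ℝ), GeneratorOnCoordinates 𝓕 Q X G b) ∧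
    ∀ (G : Matrix (Fin n) (Fin n) ℝ) (b : Fin n → ℝ), GeneratorOnCoordinates 𝓕 Q X G b →
      IsAffineWith 𝓕 Q X
        (fun t T => NormedSpace.exp (((T : ℝ) - t) • G))
        (fun t T => ∫ s in (t : ℝ)..T, NormedSpace.exp (((T : ℝ) - s) • G) *ᵥ b) ∧
      IsHomogeneous (fun t T : ℝ≥0 => NormedSpace.exp (((T : ℝ) - t) • G)) ∧
      IsHomogeneous (fun t T : ℝ≥0 =>
        ∫ s in (t : ℝ)..T, NormedSpace.exp (((T : ℝ) - s) • G) *ᵥ b) := by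
  have hexp := fun (G : Matrix (Fin n) (Fin n) ℝ) (b : Fin n → ℝ)
    (hG : GeneratorOnCoordinates 𝓕 Q X G b) => hX.isAffineWith hX0 hG
  obtain ⟨G, b, hG⟩ := hX.exists_generatorOnCoordinates
  refine ⟨(hexp G b hG).integrable, ⟨_, _, hexp G b hG⟩, ⟨G, b, hG⟩, fun G b hG =>
    ⟨hexp G b hG, ⟨fun r => NormedSpace.exp ((r : ℝ) • G), fun t T htT => ?_⟩,
      ⟨fun r => ∫ v in (0 : ℝ)..r, NormedSpace.exp (v • G) *ᵥ b, fun t T htT => ?_⟩⟩⟩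
  · simp only [NNReal.coe_sub htT]
  · simp only [NNReal.coe_sub htT, integral_exp_mulVec_eq]
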